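/- Let $\mathbb{K}$ be a field, let $\mathcal{L}$ be the lattice of all vector subspaces of $\mathbb{K}^n$, ordered by inclusion, with minimum $\mathbf{0}=\{0\}$, and let $K(\mathcal{L})$ be its orthoscheme complex: its points are the formal convex combinations $x=\sum_p \lambda(p)\,p$ of subspaces whose support $\{p:\lambda(p)\ne 0\}$ is a chain; the simplex of a maximal chain $p_0\subset p_1\subset\cdots\subset p_n$ (the set of all points supported in the chain) carries the Euclidean metric transported from $\mathbb{R}^n$ by $\sum_i\lambda_i p_i\mapsto\sum_{i}\lambda_i(e_1+\cdots+e_i)$, and $d$ is the resulting length metric on $K(\mathcal{L})$. Let $\overline{\dim}(x)=\sum_p\lambda(p)\dim p$ be the Lovász extension of the dimension. For $c>0$ put $f(x)=-\overline{\dim}(x)+c\,d(\mathbf{0},x)^2$, and for $\lambda>0$ and $x^0\in K(\mathcal{L})$ let $$J^f_\lambda(x^0)=\mathop{\mathrm{argmin}}_{x\in K(\mathcal{L})}\Bigl(f(x)+\tfrac1{2\lambda}d(x^0,x)^2\Bigr).$$ A frame is the set $\mathcal{F}=\{\sum_{i\in X}a_i : X\subseteq\{1,\dots,n\}\}$ of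 all sums of members of a family of one-dimensional subspaces $a_1,\dots,a_n$ with $a_1+\cdots+a_n=\mathbb{K}^n$; $K(\mathcal{F})$ is the set of points supported in $\mathcal{F}$, and the $\mathcal{F}$-coordinates of $x=\sum_p\lambda(p)p\in K(\mathcal{F})$ are $x_i=\sum_{p\supseteq a_i}\lambda(p)\in[0,1]$ $(1\le i\le n)$. 1. For all real $c,\lambda>0$ and every $x^0\in K(\mathcal{L})$ the minimizer $x^*=J^f_\lambda(x^0)$ exists and is unique. It lies in every maximal simplex that contains $x^0$. There is a frame $\mathcal{F}$ with $x^0\in K(\mathcal{F})$, and for every such frame $x^*\in K(\mathcal{F})$ and the $\mathcal{F}$-coordinates of $x^*$ are obtained coordinatewise: $x^*_i$ minimizes $-t+ct^2+\frac1{2\lambda}(t-x^0_i)^2$ over $t\in[0,1]$, that is, $$x^*_i=\max\Bigl\{0,\ \min\Bigl\{1,\ \frac{x^0_i+\lambda}{1+2c\lambda}\Bigr\}\Bigr\}\qquad(1\le i\le n).$$ 2. The resolvent is computed in polynomial time: there are one program, independent of $\mathbb{K}$ and of $n$, and one polynomial $q$ such that for every field $\mathbb{K}$, every $n$, all rational $c,\lambda>0$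 and every point $x^0=\sum_k\mu_kp_k$ with rational coefficients, given by $n$, by $c$ and $\lambda$, by a finite chain $p_1\subsetneq p_2\subsetneq\cdots$ of subspaces containing the support of $x^0$ (each with its dimension and a basis) and by the coefficients $\mu_k\ge 0$, the program halts within time $q(n+b)$ and outputs $J^f_\lambda(x^0)$ in the same form. Here rational numbers are given as fractions of integers in binary, and $b$ is the total bit length of the numerators and denominators of $c$, $\lambda$ and the $\mu_k$. The machine is a random access machine with integer arrays and arrays of elements of $\mathbb{K}$; an operation or zero test in $\mathbb{K}$ takes one unit of time, and every integer computed is charged its bit length. In particular, this holds for $c=1/(4n)$ and $c=1/(8n)$ with $n\ge1$. -/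

import Mathlib

universe u

noncomputable section

namespace Orthoscheme

/-! ## The orthoscheme complex of the lattice of subspaces -/

/-- The lattice of all vector subspaces of `K ^ n`, ordered by inclusion. Its rank function is
the dimension `Module.finrank K`, and the lattice has rank `n`. -/
abbrev SubLattice (K : Type u) [Field K] (n : ℕ) : Type u := Submodule K (Fin n → K)

/-- The points of `K(L)`, for `L` the lattice of subspaces of `K ^ n`: the formal convex
combinations `∑ weight p • p` of elements of `L` whose support is a chain. -/
@[ext]
structure OrthoComplex (K : Type u) [Field K] (n : ℕ) where
  weight : SubLattice K n →₀ ℝ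
  nonneg : ∀ p, 0 ≤ weight p
  sum_eq_one : ∑ p ∈ weight.support, weight p = 1
  isChain : IsChain (· ≤ ·) (weight.support : Set (SubLattice K n))

variable {K : Type u} [Field K] {n : ℕ}

/-- The support of a point, as a set of subspaces. -/
def OrthoComplex.supp (x : OrthoComplex K n) : Set (SubLattice K n) := (x.weight.support : Set (SubLattice K n))

/-- A subspace as a vertex of the complex. -/
def vertex (p : SubLattice K n) : OrthoComplex K n where
  weight := Finsupp.single p 1
  nonneg q := by
    classical
    rw [Finsupp.single_apply]
    split_ifs <;> norm_num
  sum_eq_one := by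
    rw [Finsupp.support_single p one_ne_zero]
    simp
  isChain := by
    rw [Finsupp.support_single p one_ne_zero]
    simp

/-- The subcomplex of the points supported in `S`. For a chain `S` it is the simplex
corresponding to `S`, for a frame `S` it is the subcomplex `K(S)`. -/
def subcomplex (S : Set (SubLattice K n)) : Set (OrthoComplex K n) := {x | x.supp ⊆ S}

/-- The position of a point in the standard orthoscheme. If `x = ∑ i, l i • p i` lies in the
simplex `σ` of a maximal chain `p 0 < p 1 < ⋯ < p n` (so `p i` has dimension `i`), then this is
`φ_σ(x) = ∑ i, l i • 1_{{1, …, i}}`: its coordinate of index `j` (counted from `0`) is the sum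
of the `l i` with `j + 1 ≤ i`. -/
def level (x : OrthoComplex K n) : EuclideanSpace ℝ (Fin n) :=
  WithLp.toLp 2 fun j =>
    ∑ p ∈ x.weight.support, if (j : ℕ) < Module.finrank K p then x.weight p else 0

/-- Two points lie in a common simplex. -/
def InCommonSimplex (x y : OrthoComplex K n) : Prop :=
  ∃ C : Set (SubLattice K n), IsMaxChain (· ≤ ·) C ∧ x ∈ subcomplex C ∧ y ∈ subcomplex C

/-- `l` is the length of a string from `x` to `y`: a finite sequence of points in which
consecutive points lie in a common simplex `σ`, and are joined at the cost of their distance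
`d_σ` in the Euclidean metric of `σ`. -/
def IsStringLength (x y : OrthoComplex K n) (l : ℝ) : Prop :=
  ∃ (m : ℕ) (z : ℕ → OrthoComplex K n), z 0 = x ∧ z m = y ∧
    (∀ i < m, InCommonSimplex (z i) (z (i + 1))) ∧
    l = ∑ i ∈ Finset.range m, ‖level (z i) - level (z (i + 1))‖

/-- The length metric of the orthoscheme complex: the infimum of the lengths of the strings
(equivalently, of the piecewise linear paths) from `x` to `y`. -/
def orthoDist (x y : OrthoComplex K n) : ℝ := sInf {l | IsStringLength x y l}

/-- The Lovász extension of a function on the lattice. -/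
def lovasz (f : SubLattice K n → ℝ) (x : OrthoComplex K n) : ℝ :=
  ∑ p ∈ x.weight.support, x.weight p * f p

/-- The function `-dim̄ + c d(0, ·)²` on `K(L)`. -/
def objective (c : ℝ) (x : OrthoComplex K n) : ℝ :=
  -lovasz (fun p => (Module.finrank K p : ℝ)) x + c * orthoDist (vertex ⊥) x ^ 2

/-- `y` is a minimizer of `z ↦ f z + (1 / (2 lam)) d(x, z)²` over the complex, that is, a value
at `x` of the resolvent of `f` with parameter `lam`. -/
def IsResolvent (f : OrthoComplex K n → ℝ) (lam : ℝ) (x y : OrthoComplex K n) : Prop :=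
  ∀ z : OrthoComplex K n,
    f y + 1 / (2 * lam) * orthoDist x y ^ 2 ≤ f z + 1 / (2 * lam) * orthoDist x z ^ 2

/-- A base of the lattice: `n` atoms whose join is the maximum. -/
def IsBase (a : Fin n → SubLattice K n) : Prop := (∀ i, IsAtom (a i)) ∧ ⨆ i, a i = ⊤

/-- The frame of a base: the joins of subsets of the base. -/
def frame (a : Fin n → SubLattice K n) : Set (SubLattice K n) :=
  Set.range fun X : Finset (Fin n) => ⨆ i ∈ X, a i

open Classical in
/-- The coordinates of a point `x` of `K(F)`, for the frame `F` of the base `a`: the vector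
`∑ p, weight p • 1_{X p}`, where `X p` is the set of the indices `i` with `a i ≤ p`. -/
def frameCoord (a : Fin n → SubLattice K n) (x : OrthoComplex K n) (i : Fin n) : ℝ :=
  ∑ p ∈ x.weight.support, if a i ≤ p then x.weight p else 0

end Orthoscheme

namespace FieldRAM

/-! ## Random access machines over a field

The machine has arrays of integers and arrays of elements of a field `K`, with indirect
addressing. A program is a finite object that does not depend on `K`. Time is counted with the
logarithmic cost criterion on integers (every integer that is computed is charged its bit
length, array indices included), while an operation or a zero test in `K` costs one unit. -/

/-- The memory: `int a i` is the entry `i` of the integer array `a`, and `fld a i` is the entry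
`i` of the field array `a`. -/
structure State (K : Type u) where
  int : ℕ → ℕ → ℤ
  fld : ℕ → ℕ → K

/-- Integer expressions. -/
inductive IExp : Type
  | const (z : ℤ)
  | get (a : ℕ) (i : IExp)
  | add (e f : IExp)
  | sub (e f : IExp)
  | mul (e f : IExp)

/-- Field expressions. -/
inductive FExp : Type
  | zero
  | one
  | get (a : ℕ) (i : IExp)
  | add (e f : FExp)
  | sub (e f : FExp)
  | mul (e f : FExp)
  | inv (e : FExp)

/-- Tests: comparison of integers, and the zero test in the field. -/
inductive Test : Type
  | lt (e f : IExp)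
  | isZero (e : FExp)

/-- Programs. -/
inductive Prog : Type
  | skip
  | setInt (a : ℕ) (i : IExp) (e : IExp)
  | setFld (a : ℕ) (i : IExp) (e : FExp)
  | seq (P Q : Prog)
  | ite (b : Test) (P Q : Prog)
  | loop (b : Test) (P : Prog)

/-- The number of binary digits of `|z|`. -/
def bits (z : ℤ) : ℕ := Nat.size z.natAbs

variable {K : Type u} [Field K]

/-- The value of an integer expression (a negative index is read as `0`). -/
def IExp.eval (s : State K) : IExp → ℤ
  | .const z => z
  | .get a i => s.int a (i.eval s).toNat
  | .add e f => e.eval s + f.eval s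
  | .sub e f => e.eval s - f.eval s
  | .mul e f => e.eval s * f.eval s

/-- The time for evaluating an integer expression. -/
def IExp.cost (s : State K) : IExp → ℕ
  | .const z => 1 + bits z
  | .get a i => 1 + i.cost s + bits (IExp.eval s (.get a i))
  | .add e f => 1 + e.cost s + f.cost s + bits (IExp.eval s (.add e f))
  | .sub e f => 1 + e.cost s + f.cost s + bits (IExp.eval s (.sub e f))
  | .mul e f => 1 + e.cost s + f.cost s + bits (IExp.eval s (.mul e f))

/-- The value of a field expression (the inverse of `0` is `0`). -/
def FExp.eval (s : State K) : FExp → K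
  | .zero => 0
  | .one => 1
  | .get a i => s.fld a (i.eval s).toNat
  | .add e f => e.eval s + f.eval s
  | .sub e f => e.eval s - f.eval s
  | .mul e f => e.eval s * f.eval s
  | .inv e => (e.eval s)⁻¹

/-- The time for evaluating a field expression. -/
def FExp.cost (s : State K) : FExp → ℕ
  | .zero => 1
  | .one => 1
  | .get _ i => 1 + i.cost s
  | .add e f => 1 + e.cost s + f.cost s
  | .sub e f => 1 + e.cost s + f.cost s
  | .mul e f => 1 + e.cost s + f.cost s
  | .inv e => 1 + e.cost s

/-- The truth of a test. -/
def Test.Holds (s : State K) : Test → Prop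
  | .lt e f => e.eval s < f.eval s
  | .isZero e => e.eval s = 0

/-- The time for a test. -/
def Test.cost (s : State K) : Test → ℕ
  | .lt e f => 1 + e.cost s + f.cost s
  | .isZero e => 1 + e.cost s

/-- Write `z` into the entry `i` of the integer array `a`. -/
def State.writeInt (s : State K) (a i : ℕ) (z : ℤ) : State K :=
  { s with int := Function.update s.int a (Function.update (s.int a) i z) }

/-- Write `z` into the entry `i` of the field array `a`. -/
def State.writeFld (s : State K) (a i : ℕ) (z : K) : State K :=
  { s with fld := Function.update s.fld a (Function.update (s.fld a) i z) }

/-- `Exec P s t s'`: started in `s`, the program `P` halts after time `t` in `s'`. -/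
inductive Exec : Prog → State K → ℕ → State K → Prop
  | skip (s : State K) : Exec .skip s 1 s
  | setInt (a : ℕ) (i e : IExp) (s : State K) :
      Exec (.setInt a i e) s (1 + i.cost s + e.cost s)
        (s.writeInt a (i.eval s).toNat (e.eval s))
  | setFld (a : ℕ) (i : IExp) (e : FExp) (s : State K) :
      Exec (.setFld a i e) s (1 + i.cost s + e.cost s)
        (s.writeFld a (i.eval s).toNat (e.eval s))
  | seq {P Q : Prog} {s s' s'' : State K} {t t' : ℕ} :
      Exec P s t s' → Exec Q s' t' s'' → Exec (.seq P Q) s (t + t') s''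
  | ite_true {b : Test} {P Q : Prog} {s s' : State K} {t : ℕ} :
      b.Holds s → Exec P s t s' → Exec (.ite b P Q) s (b.cost s + t) s'
  | ite_false {b : Test} {P Q : Prog} {s s' : State K} {t : ℕ} :
      ¬ b.Holds s → Exec Q s t s' → Exec (.ite b P Q) s (b.cost s + t) s'
  | loop_done {b : Test} {P : Prog} {s : State K} :
      ¬ b.Holds s → Exec (.loop b P) s (b.cost s) s
  | loop_step {b : Test} {P : Prog} {s s' s'' : State K} {t t' : ℕ} :
      b.Holds s → Exec P s t s' → Exec (.loop b P) s' t' s'' →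
      Exec (.loop b P) s (b.cost s + t + t') s''

/-! ## Points of the complex in the memory of a machine -/

/-- The vector of `K ^ n` that is stored in the field array `a` as the vector `j` of the
subspace `k`; every subspace has room for `n` vectors. -/
def storedVector (s : State K) (n a k j : ℕ) : Fin n → K :=
  fun r => s.fld a ((k * n + j) * n + r)

/-- The bank `b` of the memory (the integer arrays `4 b + 1, …, 4 b + 4` and the field array
`b`) holds the point `x = ∑ k, (num k / den k) • p k`: the length of a strictly increasing
sequence of subspaces `p 0 < p 1 < ⋯` that contains the support of `x`, and for every `k` the
dimension of `p k`, a basis of `p k`, and the numerator and the denominator of the coefficient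
of `p k` (zero coefficients are allowed). -/
def HoldsPoint (s : State K) (b n : ℕ) (x : Orthoscheme.OrthoComplex K n) : Prop :=
  ∃ (m : ℕ) (p : Fin m → Orthoscheme.SubLattice K n),
    StrictMono p ∧ x.supp ⊆ Set.range p ∧ s.int (4 * b + 1) 0 = m ∧
    ∀ k : Fin m,
      s.int (4 * b + 2) k = Module.finrank K (p k) ∧
      Submodule.span K
        (Set.range fun j : Fin (Module.finrank K (p k)) => storedVector s n b k j) = p k ∧
      0 < s.int (4 * b + 4) k ∧
      x.weight (p k) = (s.int (4 * b + 3) k : ℝ) / (s.int (4 * b + 4) k : ℝ)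

/-- The memory holds the input `(n, lam, c, x)`: the integer array `0` holds `n` and the
numerators and denominators of `lam` and `c`, and the bank `0` holds `x`. Nothing is assumed on
the rest of the memory. -/
def HoldsInput (s : State K) (n : ℕ) (lam c : ℝ) (x : Orthoscheme.OrthoComplex K n) : Prop :=
  s.int 0 0 = n ∧
  0 < s.int 0 2 ∧ lam = (s.int 0 1 : ℝ) / (s.int 0 2 : ℝ) ∧
  0 < s.int 0 4 ∧ c = (s.int 0 3 : ℝ) / (s.int 0 4 : ℝ) ∧
  HoldsPoint s 0 n x

/-- The size of an input: `n` plus the total bit length of the numerators and denominators of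
`lam`, of `c` and of the coefficients of the point. -/
def inputSize (s : State K) : ℕ :=
  (s.int 0 0).toNat + (bits (s.int 0 1) + bits (s.int 0 2)) +
    (bits (s.int 0 3) + bits (s.int 0 4)) +
    ∑ k ∈ Finset.range (s.int 1 0).toNat, (bits (s.int 3 k) + bits (s.int 4 k))

end FieldRAM

end

open Orthoscheme FieldRAM

open Orthoscheme FieldRAM

/-! The problem decouples into one-variable problems. A rank map `J` assigns to every subspace,
monotonically, as many indices as its dimension, and `position J` sends a point to the corresponding
combination of indicator vectors. Along a chain the index sets are nested, so the inner products of
their indicators depend only on dimensions. Hence `position J` is isometric on every simplex and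
never increases the length metric (`norm_sub_le_orthoDist`). Distances from the bottom vertex are
exact, since it shares a simplex with every point, and the Lovász extension of the dimension is the
sum of the coordinates. The function to be minimized is therefore bounded below by a sum of strictly
convex functions of the single coordinates, with equality in standard coordinates on the simplexes
through the given point (`sum_coordObjective_position_le`, `sum_coordObjective_level`).

Existence: the one-variable minimizer is a monotone function `φ` of the given coordinate, with
values in the unit interval. The point whose coordinates are all transformed by `φ` is explicit
(`mapCoord`): its weights are differences of `φ` at consecutive tail sums of the old weights. At
most `⊥` and `⊤` are added to the support, which settles membership in maximal simplexes and in
frames. By telescoping, `φ` is applied to the mass of every upper set that contains `⊤` but not `⊥`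
(`sum_mapCoord_weight`); standard coordinates and frame coordinates are both masses of such sets.

Uniqueness: take a complete flag `q` through the given point `x` and the constructed minimizer `y`.
The rank map `jumps q`, which records where the intersection of a subspace with the flag grows,
gives the standard coordinates on the simplex of `q`. Quadratic growth of the one-variable functions
forces any minimizer to have the same `jumps q`-coordinates as `y` (`IsResolvent.position_eq`).
These are nonincreasing, and only the points of the simplex of `q` have nonincreasing coordinates
(`IsCompleteFlag.mem_range_of_antitone`); there the coordinates determine the point
(`eq_of_level_eq`).

Complexity: the program inserts the minimum and the maximum where they are missing and descends the
chain, keeping the tail sum as an unreduced fraction. Its denominators multiply, so their bit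
lengths add up to at most the input size plus a constant; its numerators are no larger because tail
sums are at most 1. Each value of `φ` is computed from the current tail sum and never from an
earlier value of `φ`, so lengths do not accumulate. -/

namespace Orthoscheme

variable {K : Type u} [Field K] {n : ℕ}

/-! ## Coordinates of the complex given by rank maps -/

/-- A rank map sends subspaces monotonically to sets of as many indices as the dimension says. -/
structure IsRankMap (J : SubLattice K n → Finset (Fin n)) : Prop where
  mono : Monotone J
  card : ∀ p, (J p).card = Module.finrank K p

/-- The vector `∑ p, v p • 1_{J p}`. -/
noncomputable def position (J : SubLattice K n → Finset (Fin n)) (v : SubLattice K n →₀ ℝ) :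
    EuclideanSpace ℝ (Fin n) :=
  WithLp.toLp 2 fun j => v.sum fun p w => if j ∈ J p then w else 0

theorem position_apply (J : SubLattice K n → Finset (Fin n)) (v : SubLattice K n →₀ ℝ)
    (j : Fin n) : position J v j = ∑ p ∈ v.support, if j ∈ J p then v p else 0 := rfl

theorem position_sub (J : SubLattice K n → Finset (Fin n)) (v w : SubLattice K n →₀ ℝ) :
    position J (v - w) = position J v - position J w := by
  ext j
  let f : SubLattice K n → ℝ → ℝ := fun p t => if j ∈ J p then t else 0
  change (v - w).sum f = v.sum f - w.sum f
  refine Finsupp.sum_sub_index fun p a b => ?_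
  by_cases h : j ∈ J p <;> simp [f, h]

theorem finrank_le (p : SubLattice K n) : Module.finrank K p ≤ n := by
  simpa using Submodule.finrank_le p

/-- The rank map whose values are the initial segments. -/
noncomputable def initialSegment (p : SubLattice K n) : Finset (Fin n) :=
  Finset.univ.filter fun j => (j : ℕ) < Module.finrank K p

theorem isRankMap_initialSegment : IsRankMap (initialSegment (K := K) (n := n)) where
  mono p r h j := by
    simp only [initialSegment, Finset.mem_filter, Finset.mem_univ, true_and]
    exact fun hj => hj.trans_le (Submodule.finrank_mono h)
  card p := by
    rw [initialSegment, Fin.card_filter_val_lt]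
    exact min_eq_right (finrank_le p)

theorem level_eq_position (x : OrthoComplex K n) : level x = position initialSegment x.weight := by
  ext j
  simp [level, position_apply, initialSegment]

/-- Every subspace is counted once for each index of `J p`. This turns the Lovász extension of the
dimension into the sum of the coordinates, for every rank map. -/
theorem sum_position {J : SubLattice K n → Finset (Fin n)} (hJ : IsRankMap J)
    (v : SubLattice K n →₀ ℝ) :
    ∑ j, position J v j = ∑ p ∈ v.support, v p * (Module.finrank K p : ℝ) := by
  simp only [position_apply]
  rw [Finset.sum_comm]
  refine Finset.sum_congr rfl fun p _ => ?_
  rw [← Finset.sum_filter, Finset.sum_const, ← hJ.card p]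
  simp [mul_comm]

/-- The inner product of the indicators of `J p` and `J r` is the size of the intersection, and for
comparable `p`, `r` this is the smaller dimension. The right-hand side does not involve `J`. Signs
of `v` are arbitrary, so that differences of points are covered. -/
theorem norm_position_sq {J : SubLattice K n → Finset (Fin n)} (hJ : IsRankMap J)
    {v : SubLattice K n →₀ ℝ} (hv : IsChain (· ≤ ·) (v.support : Set (SubLattice K n))) :
    ‖position J v‖ ^ 2 = ∑ p ∈ v.support, ∑ r ∈ v.support,
      v p * v r * (min (Module.finrank K p) (Module.finrank K r) : ℕ) := by
  rw [EuclideanSpace.real_norm_sq_eq]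
  simp only [position_apply, sq, Finset.sum_mul_sum]
  rw [Finset.sum_comm]
  refine Finset.sum_congr rfl fun p hp => ?_
  rw [Finset.sum_comm]
  refine Finset.sum_congr rfl fun r hr => ?_
  have hcard : (J p ∩ J r).card = min (Module.finrank K p) (Module.finrank K r) := by
    rcases hv.total hp hr with h | h
    · rw [Finset.inter_eq_left.2 (hJ.mono h), hJ.card, min_eq_left (Submodule.finrank_mono h)]
    · rw [Finset.inter_eq_right.2 (hJ.mono h), hJ.card, min_eq_right (Submodule.finrank_mono h)]
  have : ∀ j : Fin n, ((if j ∈ J p then v p else 0) * if j ∈ J r then v r else 0)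
      = if j ∈ J p ∩ J r then v p * v r else 0 := by
    intro j
    by_cases h1 : j ∈ J p <;> by_cases h2 : j ∈ J r <;> simp [h1, h2]
  simp only [this]
  rw [← Finset.sum_filter, Finset.sum_const, ← hcard, Finset.filter_mem_eq_inter,
    Finset.univ_inter, nsmul_eq_mul, mul_comm]

theorem norm_position_eq {J J' : SubLattice K n → Finset (Fin n)} (hJ : IsRankMap J)
    (hJ' : IsRankMap J') {v : SubLattice K n →₀ ℝ}
    (hv : IsChain (· ≤ ·) (v.support : Set (SubLattice K n))) :
    ‖position J v‖ = ‖position J' v‖ := by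
  have h := (norm_position_sq hJ hv).trans (norm_position_sq hJ' hv).symm
  exact (sq_eq_sq₀ (norm_nonneg _) (norm_nonneg _)).1 h

theorem position_mem_Icc (J : SubLattice K n → Finset (Fin n)) (x : OrthoComplex K n) (j : Fin n) :
    position J x.weight j ∈ Set.Icc (0 : ℝ) 1 := by
  rw [position_apply]
  constructor
  · exact Finset.sum_nonneg fun p _ => by split_ifs; exacts [x.nonneg p, le_rfl]
  · rw [← x.sum_eq_one]
    exact Finset.sum_le_sum fun p _ => by split_ifs; exacts [le_rfl, x.nonneg p]

theorem isChain_support_sub {C : Set (SubLattice K n)} (hC : IsChain (· ≤ ·) C)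
    {x y : OrthoComplex K n} (hx : x ∈ subcomplex C) (hy : y ∈ subcomplex C) :
    IsChain (· ≤ ·) ((x.weight - y.weight).support : Set (SubLattice K n)) := by
  classical
  refine hC.mono fun p hp => ?_
  rcases Finset.mem_union.1 (Finsupp.support_sub hp) with h | h
  exacts [hx h, hy h]

/-- The difference of the weights is supported in one chain, where all rank maps give the same norm;
the standard coordinates are those of the rank map of initial segments. -/
theorem norm_position_sub_position {J : SubLattice K n → Finset (Fin n)} (hJ : IsRankMap J)
    {x y : OrthoComplex K n} (h : InCommonSimplex x y) :
    ‖position J x.weight - position J y.weight‖ = ‖level x - level y‖ := by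
  obtain ⟨C, hC, hx, hy⟩ := h
  rw [level_eq_position, level_eq_position, ← position_sub, ← position_sub]
  exact norm_position_eq hJ isRankMap_initialSegment (isChain_support_sub hC.1 hx hy)

/-! ## The length metric -/

theorem vertex_mem_subcomplex {p : SubLattice K n} {C : Set (SubLattice K n)} (h : p ∈ C) :
    vertex p ∈ subcomplex C := by
  intro r hr
  simp only [OrthoComplex.supp, vertex, Finset.mem_coe, Finsupp.mem_support_iff,
    Finsupp.single_apply, ne_eq, ite_eq_right_iff, one_ne_zero, imp_false, not_not] at hr
  exact hr ▸ h

theorem InCommonSimplex.symm {x y : OrthoComplex K n} (h : InCommonSimplex x y) :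
    InCommonSimplex y x := by
  obtain ⟨C, hC, hx, hy⟩ := h
  exact ⟨C, hC, hy, hx⟩

theorem inCommonSimplex_vertex_bot (x : OrthoComplex K n) : InCommonSimplex (vertex ⊥) x := by
  obtain ⟨C, hC, hx⟩ := x.isChain.exists_maxChain
  exact ⟨C, hC, vertex_mem_subcomplex hC.bot_mem, hx⟩

theorem exists_isStringLength (x y : OrthoComplex K n) : ∃ l, IsStringLength x y l := by
  -- Any two points are joined through the bottom vertex, which lies in every maximal simplex. So
  -- the infimum defining the metric is never over the empty set.
  refine ⟨_, 2, fun i => if i = 0 then x else if i = 1 then vertex ⊥ else y, rfl, rfl, ?_, rfl⟩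
  intro i hi
  interval_cases i
  · exact (inCommonSimplex_vertex_bot x).symm
  · exact inCommonSimplex_vertex_bot y

theorem IsStringLength.norm_le {x y : OrthoComplex K n} {l : ℝ} (h : IsStringLength x y l)
    {J : SubLattice K n → Finset (Fin n)} (hJ : IsRankMap J) :
    ‖position J x.weight - position J y.weight‖ ≤ l := by
  obtain ⟨m, z, rfl, rfl, hz, rfl⟩ := h
  rw [← dist_eq_norm]
  refine (dist_le_range_sum_dist (fun i => position J (z i).weight) m).trans ?_
  refine Finset.sum_le_sum fun i hi => ?_
  rw [dist_eq_norm, norm_position_sub_position hJ (hz i (Finset.mem_range.1 hi))]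

/-- Rank maps give maps to the Euclidean space that do not increase distances. -/
theorem norm_sub_le_orthoDist {J : SubLattice K n → Finset (Fin n)} (hJ : IsRankMap J)
    (x y : OrthoComplex K n) :
    ‖position J x.weight - position J y.weight‖ ≤ orthoDist x y :=
  le_csInf (exists_isStringLength x y) fun _ h => h.norm_le hJ

/-- The string with a single step gives the upper bound, and the rank map of initial segments gives
the lower bound. -/
theorem orthoDist_eq_of_inCommonSimplex {x y : OrthoComplex K n} (h : InCommonSimplex x y) :
    orthoDist x y = ‖level x - level y‖ := by
  refine le_antisymm (csInf_le ⟨0, ?_⟩ ?_) ?_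
  · rintro l hl
    exact (norm_nonneg _).trans (hl.norm_le isRankMap_initialSegment)
  · refine ⟨1, fun i => if i = 0 then x else y, rfl, rfl, ?_, by simp⟩
    intro i hi
    interval_cases i
    simpa using h
  · rw [level_eq_position, level_eq_position]
    exact norm_sub_le_orthoDist isRankMap_initialSegment x y

theorem orthoDist_vertex_bot {J : SubLattice K n → Finset (Fin n)} (hJ : IsRankMap J)
    (x : OrthoComplex K n) : orthoDist (vertex ⊥) x = ‖position J x.weight‖ := by
  have h0 : level (vertex (⊥ : SubLattice K n)) = 0 := by
    ext j
    simp [level, vertex, Finsupp.support_single]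
  rw [orthoDist_eq_of_inCommonSimplex (inCommonSimplex_vertex_bot x), h0, zero_sub, norm_neg,
    level_eq_position]
  exact norm_position_eq isRankMap_initialSegment hJ x.isChain

/-! ## The one-dimensional problem -/

/-- The objective function of the resolvent problem in one coordinate. -/
noncomputable def coordObjective (c lam a t : ℝ) : ℝ :=
  -t + c * t ^ 2 + 1 / (2 * lam) * (t - a) ^ 2

/-- The minimizer of `coordObjective` over the unit interval. -/
noncomputable def coordResolvent (c lam a : ℝ) : ℝ :=
  max 0 (min 1 ((a + lam) / (1 + 2 * c * lam)))

theorem coordResolvent_mem_Icc (c lam a : ℝ) : coordResolvent c lam a ∈ Set.Icc (0 : ℝ) 1 :=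
  ⟨le_max_left _ _, max_le zero_le_one (min_le_left _ _)⟩

theorem coordResolvent_mono {c lam : ℝ} (hc : 0 < c) (hlam : 0 < lam) :
    Monotone (coordResolvent c lam) := by
  intro a b h
  unfold coordResolvent
  gcongr

/-- Quadratic growth at the constrained minimizer. The leading coefficient is `c + 1 / (2 lam)`;
keeping only `c` is enough for uniqueness. -/
theorem coordObjective_resolvent_le {c lam : ℝ} (hc : 0 < c) (hlam : 0 < lam) (a : ℝ) {t : ℝ}
    (ht : t ∈ Set.Icc (0 : ℝ) 1) :
    coordObjective c lam a (coordResolvent c lam a) + c * (t - coordResolvent c lam a) ^ 2 ≤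
      coordObjective c lam a t := by
  obtain ⟨u, hu⟩ : ∃ u, u = (a + lam) / (1 + 2 * c * lam) := ⟨_, rfl⟩
  have hpos : 0 < 1 + 2 * c * lam := by positivity
  have ha : a = u * (1 + 2 * c * lam) - lam := by rw [hu]; field_simp; ring
  obtain ⟨r, hr⟩ : ∃ r, r = coordResolvent c lam a := ⟨_, rfl⟩
  -- Clamping is the projection of the unconstrained minimizer `u` onto the unit interval; this is
  -- the variational inequality of that projection.
  have key : 0 ≤ (t - r) * (r - u) := by
    have hr' : r = max 0 (min 1 u) := by rw [hr, hu]; rfl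
    rcases le_total u 0 with h0 | h0
    · rw [max_eq_left ((min_le_right _ _).trans h0)] at hr'
      subst hr'
      nlinarith [ht.1]
    · rcases le_total u 1 with h1 | h1
      · rw [min_eq_right h1, max_eq_right h0] at hr'
        simp [hr']
      · rw [min_eq_left h1, max_eq_right zero_le_one] at hr'
        subst hr'
        nlinarith [ht.2]
  rw [← hr]
  have hid : coordObjective c lam a t - coordObjective c lam a r =
      (1 + 2 * c * lam) / (2 * lam) * ((t - r) ^ 2 + 2 * ((t - r) * (r - u))) := by
    rw [ha]
    unfold coordObjective
    field_simp
    ring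
  have hge : c * (t - r) ^ 2 ≤
      (1 + 2 * c * lam) / (2 * lam) * ((t - r) ^ 2 + 2 * ((t - r) * (r - u))) := by
    have h1 : c ≤ (1 + 2 * c * lam) / (2 * lam) := by
      rw [le_div_iff₀ (by positivity)]
      linarith
    refine mul_le_mul h1 (by linarith) (sq_nonneg _) (by positivity)
  linarith

theorem isMinOn_coordResolvent {c lam : ℝ} (hc : 0 < c) (hlam : 0 < lam) (a : ℝ) :
    IsMinOn (coordObjective c lam a) (Set.Icc 0 1) (coordResolvent c lam a) := by
  intro t ht
  have h := coordObjective_resolvent_le hc hlam a ht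
  have : 0 ≤ c * (t - coordResolvent c lam a) ^ 2 := by positivity
  exact (le_add_of_nonneg_right this).trans h

/-! ## The resolvent in coordinates -/

theorem sum_coordObjective_position {J : SubLattice K n → Finset (Fin n)} (hJ : IsRankMap J)
    (c lam : ℝ) (x z : OrthoComplex K n) :
    ∑ j, coordObjective c lam (position J x.weight j) (position J z.weight j) =
      objective c z + 1 / (2 * lam) * ‖position J x.weight - position J z.weight‖ ^ 2 := by
  rw [objective, orthoDist_vertex_bot hJ, lovasz, ← sum_position hJ, norm_sub_rev,
    EuclideanSpace.real_norm_sq_eq, EuclideanSpace.real_norm_sq_eq]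
  simp [coordObjective, Finset.sum_add_distrib, Finset.mul_sum]

theorem sum_coordObjective_position_le {J : SubLattice K n → Finset (Fin n)} (hJ : IsRankMap J)
    (c : ℝ) {lam : ℝ} (hlam : 0 < lam) (x z : OrthoComplex K n) :
    ∑ j, coordObjective c lam (position J x.weight j) (position J z.weight j) ≤
      objective c z + 1 / (2 * lam) * orthoDist x z ^ 2 := by
  rw [sum_coordObjective_position hJ]
  gcongr
  exact norm_sub_le_orthoDist hJ x z

theorem sum_coordObjective_level {c lam : ℝ} {x z : OrthoComplex K n} (h : InCommonSimplex x z) :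
    ∑ j, coordObjective c lam (level x j) (level z j) =
      objective c z + 1 / (2 * lam) * orthoDist x z ^ 2 := by
  rw [orthoDist_eq_of_inCommonSimplex h, level_eq_position, level_eq_position]
  exact sum_coordObjective_position isRankMap_initialSegment c lam x z

/-- The value at `y` is the sum of the one-variable minima, and the value at any other point is at
least such a sum evaluated at coordinates in the unit interval. -/
theorem isResolvent_of_level_eq {c lam : ℝ} (hc : 0 < c) (hlam : 0 < lam)
    {x y : OrthoComplex K n} (h : InCommonSimplex x y)
    (hy : ∀ j, level y j = coordResolvent c lam (level x j)) :
    IsResolvent (objective c) lam x y := by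
  intro z
  rw [← sum_coordObjective_level h]
  refine le_trans ?_ (sum_coordObjective_position_le isRankMap_initialSegment c hlam x z)
  rw [← level_eq_position, ← level_eq_position]
  refine Finset.sum_le_sum fun j _ => ?_
  rw [hy]
  refine isMinOn_coordResolvent hc hlam _ ?_
  rw [level_eq_position]
  exact position_mem_Icc _ _ _

/-- The value at `y'` is at most the value at `y`, which is the sum of the one-variable minima. The
rank map bounds the former below by the same sum plus `c` times the squared distance of the
coordinates, so this distance vanishes. -/
theorem IsResolvent.position_eq {c lam : ℝ} (hc : 0 < c) (hlam : 0 < lam)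
    {x y y' : OrthoComplex K n} (h : InCommonSimplex x y)
    (hy : ∀ j, level y j = coordResolvent c lam (level x j))
    (hy' : IsResolvent (objective c) lam x y') {J : SubLattice K n → Finset (Fin n)}
    (hJ : IsRankMap J) (hx : position J x.weight = level x) :
    position J y'.weight = level y := by
  have h1 := (sum_coordObjective_position_le hJ c hlam x y').trans (hy' y)
  rw [← sum_coordObjective_level h, hx] at h1
  have h2 : ∑ j, (coordObjective c lam (level x j) (level y j) +
      c * (position J y'.weight j - level y j) ^ 2) ≤
      ∑ j, coordObjective c lam (level x j) (position J y'.weight j) := by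
    refine Finset.sum_le_sum fun j _ => ?_
    rw [hy]
    exact coordObjective_resolvent_le hc hlam _ (position_mem_Icc _ _ _)
  rw [Finset.sum_add_distrib] at h2
  have h3 : ∑ j, c * (position J y'.weight j - level y j) ^ 2 ≤ 0 := by linarith
  have h4 := (Finset.sum_eq_zero_iff_of_nonneg (fun j _ => by positivity)).1
    (le_antisymm h3 (Finset.sum_nonneg fun j _ => by positivity))
  ext j
  have h5 := h4 j (Finset.mem_univ j)
  simpa [hc.ne', sub_eq_zero] using h5

/-! ## Complete flags -/

/-- A complete flag, as a sequence of subspaces (constant from the index `n` on). -/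
structure IsCompleteFlag (q : ℕ → SubLattice K n) : Prop where
  mono : Monotone q
  finrank_eq : ∀ i, Module.finrank K (q i) = min i n

theorem eq_of_le_of_finrank_le {p r : SubLattice K n} (h : p ≤ r)
    (h' : Module.finrank K r ≤ Module.finrank K p) : p = r :=
  Submodule.eq_of_le_of_finrank_le h h'

/-- If the dimension `i` were skipped, take the largest member `p` below the gap and the smallest
member `r` above it. Adding to `p` one vector of `r` gives a subspace comparable with the whole
chain, hence a member by maximality; its dimension is below `i` but above that of `p`. -/
theorem IsMaxChain.exists_finrank_eq {C : Set (SubLattice K n)} (hC : IsMaxChain (· ≤ ·) C)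
    {i : ℕ} (hi : i ≤ n) : ∃ p ∈ C, Module.finrank K p = i := by
  by_contra! hne
  obtain ⟨p, ⟨hpC, hpi⟩, hp⟩ : ∃ p, (p ∈ C ∧ Module.finrank K p < i) ∧
      ∀ r, r ∈ C → Module.finrank K r < i → Module.finrank K r ≤ Module.finrank K p := by
    have hbdd : BddAbove
        {d | ∃ p, (p ∈ C ∧ Module.finrank K p < i) ∧ Module.finrank K p = d} :=
      ⟨i, by rintro _ ⟨p, ⟨-, h⟩, rfl⟩; exact h.le⟩
    have h0 : (⊥ : SubLattice K n) ∈ C ∧ Module.finrank K (⊥ : SubLattice K n) < i :=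
      ⟨hC.bot_mem, lt_of_le_of_ne (by simp) (hne _ hC.bot_mem)⟩
    obtain ⟨p, hp, hpd⟩ := Nat.sSup_mem (s := {d | ∃ p : SubLattice K n,
      (p ∈ C ∧ Module.finrank K p < i) ∧ Module.finrank K p = d}) ⟨_, ⊥, h0, rfl⟩ hbdd
    exact ⟨p, hp, fun r h1 h2 => hpd ▸ le_csSup hbdd ⟨r, ⟨h1, h2⟩, rfl⟩⟩
  obtain ⟨r, ⟨hrC, hri⟩, hr⟩ : ∃ r, (r ∈ C ∧ i < Module.finrank K r) ∧
      ∀ s, s ∈ C → i < Module.finrank K s → Module.finrank K r ≤ Module.finrank K s := by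
    have h0 : (⊤ : SubLattice K n) ∈ C ∧ i < Module.finrank K (⊤ : SubLattice K n) :=
      ⟨hC.top_mem, lt_of_le_of_ne (by simpa using hi) (hne _ hC.top_mem).symm⟩
    obtain ⟨r, hr, hrd⟩ := Nat.sInf_mem (s := {d | ∃ p : SubLattice K n,
      (p ∈ C ∧ i < Module.finrank K p) ∧ Module.finrank K p = d}) ⟨_, ⊤, h0, rfl⟩
    exact ⟨r, hr, fun s h1 h2 => hrd ▸ Nat.sInf_le ⟨s, ⟨h1, h2⟩, rfl⟩⟩
  have hpr : p ≤ r := by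
    rcases hC.1.total hpC hrC with h | h
    · exact h
    · have := Submodule.finrank_mono h
      omega
  obtain ⟨v, hvr, hvp⟩ : ∃ v ∈ r, v ∉ p := by
    by_contra! h
    have := Submodule.finrank_mono (show r ≤ p from h)
    omega
  have hps : p < p ⊔ Submodule.span K {v} := by
    refine lt_of_le_of_ne le_sup_left fun h => hvp ?_
    rw [h]
    exact Submodule.mem_sup_right (Submodule.mem_span_singleton_self v)
  have hsr : p ⊔ Submodule.span K {v} ≤ r :=
    sup_le hpr ((Submodule.span_singleton_le_iff_mem _ _).2 hvr)
  have hs1 : Module.finrank K ↥(p ⊔ Submodule.span K {v}) ≤ Module.finrank K p + 1 :=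
    (Submodule.finrank_add_le_finrank_add_finrank _ _).trans
      (Nat.add_le_add_left ((finrank_span_le_card {v}).trans (by simp)) _)
  have hsC : p ⊔ Submodule.span K {v} ∈ C := by
    have hins : IsChain (· ≤ ·) (insert (p ⊔ Submodule.span K {v}) C) := by
      refine hC.1.insert fun b hb _ => ?_
      rcases lt_or_ge (Module.finrank K b) i with h | h
      · right
        rcases hC.1.total hb hpC with h' | h'
        · exact h'.trans le_sup_left
        · exact (eq_of_le_of_finrank_le h' (hp b hb h)) ▸ le_sup_left
      · left
        have h2 := hr b hb (lt_of_le_of_ne h (hne b hb).symm)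
        rcases hC.1.total hb hrC with h' | h'
        · exact (eq_of_le_of_finrank_le h' h2) ▸ hsr
        · exact hsr.trans h'
    rw [hC.2 hins (Set.subset_insert _ _)]
    exact Set.mem_insert _ _
  have h3 := Submodule.finrank_lt_finrank_of_lt hps
  have h4 := hp _ hsC (by have := hne _ hsC; omega)
  omega

theorem IsMaxChain.exists_isCompleteFlag {C : Set (SubLattice K n)}
    (hC : IsMaxChain (· ≤ ·) C) :
    ∃ q : ℕ → SubLattice K n, IsCompleteFlag q ∧ Set.range q = C := by
  choose q hqC hq using fun i : ℕ => exists_finrank_eq hC (min_le_right i n)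
  refine ⟨q, ⟨fun i j hij => ?_, hq⟩, Set.Subset.antisymm (Set.range_subset_iff.2 hqC) ?_⟩
  · rcases hC.1.total (hqC i) (hqC j) with h | h
    · exact h
    · exact (eq_of_le_of_finrank_le h (by rw [hq, hq]; exact min_le_min_right n hij)).ge
  · intro p hp
    refine ⟨Module.finrank K p, ?_⟩
    have h1 : Module.finrank K (q (Module.finrank K p)) = Module.finrank K p := by
      rw [hq, min_eq_left (finrank_le p)]
    rcases hC.1.total hp (hqC (Module.finrank K p)) with h | h
    · exact (eq_of_le_of_finrank_le h h1.le).symm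
    · exact eq_of_le_of_finrank_le h h1.ge

theorem exists_isCompleteFlag {C : Set (SubLattice K n)} (hC : IsChain (· ≤ ·) C) :
    ∃ q : ℕ → SubLattice K n, IsCompleteFlag q ∧ C ⊆ Set.range q ∧
      IsMaxChain (· ≤ ·) (Set.range q) := by
  obtain ⟨M, hM, hCM⟩ := hC.exists_maxChain
  obtain ⟨q, hq, rfl⟩ := IsMaxChain.exists_isCompleteFlag hM
  exact ⟨q, hq, hCM, hM⟩

/-- The indices of the jumps of the flag induced by `q` on `p`. -/
noncomputable def jumps (q : ℕ → SubLattice K n) (p : SubLattice K n) : Finset (Fin n) := by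
  classical exact Finset.univ.filter fun j => ¬ p ⊓ q (j + 1) ≤ q j

theorem mem_jumps {q : ℕ → SubLattice K n} {p : SubLattice K n} {j : Fin n} :
    j ∈ jumps q p ↔ ¬ p ⊓ q (j + 1) ≤ q j := by
  simp [jumps]

/-- Consecutive members of the flag differ by one dimension, so the intersection with `p` grows by
at most one. -/
theorem IsCompleteFlag.finrank_inf_succ {q : ℕ → SubLattice K n} (hq : IsCompleteFlag q)
    (p : SubLattice K n) (j : Fin n) :
    Module.finrank K ↥(p ⊓ q (j + 1)) =
      Module.finrank K ↥(p ⊓ q j) + if j ∈ jumps q p then 1 else 0 := by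
  have hle : p ⊓ q j ≤ p ⊓ q (j + 1) := inf_le_inf_left _ (hq.mono (Nat.le_succ _))
  split_ifs with h
  · rw [mem_jumps] at h
    have hlt : p ⊓ q j < p ⊓ q (j + 1) :=
      lt_of_le_of_ne hle fun he => h (he ▸ inf_le_right)
    have h1 := Submodule.finrank_lt_finrank_of_lt hlt
    -- The dimension formula for `p ⊓ q (j + 1)` and `q j`, whose sum stays inside `q (j + 1)`,
    -- bounds the growth by one.
    have h2 := Submodule.finrank_sup_add_finrank_inf_eq (p ⊓ q (j + 1)) (q j)
    have h3 : p ⊓ q (j + 1) ⊓ q j = p ⊓ q j := by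
      rw [inf_assoc, inf_eq_right.2 (hq.mono (Nat.le_succ (j : ℕ)))]
    have h4 := Submodule.finrank_mono (show p ⊓ q (j + 1) ⊔ q j ≤ q (j + 1) from
      sup_le inf_le_right (hq.mono (Nat.le_succ _)))
    rw [h3, hq.finrank_eq j, min_eq_left j.2.le] at h2
    rw [hq.finrank_eq, min_eq_left j.2] at h4
    omega
  · rw [mem_jumps, not_not] at h
    rw [add_zero, le_antisymm hle (le_inf inf_le_left h)]

theorem IsCompleteFlag.card_filter_jumps {q : ℕ → SubLattice K n} (hq : IsCompleteFlag q)
    (p : SubLattice K n) {i : ℕ} (hi : i ≤ n) :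
    ((jumps q p).filter fun j : Fin n => (j : ℕ) < i).card = Module.finrank K ↥(p ⊓ q i) := by
  induction i with
  | zero =>
    have h0 : q 0 = ⊥ := by
      have := hq.finrank_eq 0
      rw [Nat.zero_min] at this
      exact Submodule.finrank_eq_zero.1 this
    rw [show p ⊓ q 0 = ⊥ by rw [h0, inf_bot_eq]]
    simp
  | succ i ih =>
    have h1 := hq.finrank_inf_succ p ⟨i, hi⟩
    rw [h1, ← ih (Nat.le_of_succ_le hi)]
    have h2 : ((jumps q p).filter fun j : Fin n => (j : ℕ) < i + 1) =
        ((jumps q p).filter fun j : Fin n => (j : ℕ) < i) ∪ (jumps q p).filter fun j : Fin n => j = ⟨i, hi⟩ := by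
      ext j
      simp only [Finset.mem_filter, Finset.mem_union, Fin.ext_iff, ← and_or_left]
      exact and_congr_right fun _ => by omega
    rw [h2, Finset.card_union_of_disjoint, Finset.filter_eq']
    · split_ifs <;> simp
    · rw [Finset.disjoint_filter]
      rintro j - h rfl
      exact lt_irrefl _ h

theorem IsCompleteFlag.isRankMap_jumps {q : ℕ → SubLattice K n} (hq : IsCompleteFlag q) :
    IsRankMap (jumps q) where
  mono p r h j := by
    rw [mem_jumps, mem_jumps]
    exact fun hj h' => hj ((inf_le_inf_right _ h).trans h')
  card p := by
    have h := hq.card_filter_jumps p le_rfl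
    have htop : q n = ⊤ := by
      apply Submodule.eq_top_of_finrank_eq
      rw [hq.finrank_eq]
      simp
    rw [htop, inf_top_eq, Finset.filter_true_of_mem fun (j : Fin n) _ => j.2] at h
    exact h

/-- On the flag itself the intersections grow at every step up to `i` and then stop. This is why the
coordinates from `jumps q` are the standard ones on the simplex of `q`. -/
theorem IsCompleteFlag.jumps_apply {q : ℕ → SubLattice K n} (hq : IsCompleteFlag q) (i : ℕ) :
    jumps q (q i) = initialSegment (q i) := by
  ext j
  rw [mem_jumps, initialSegment, Finset.mem_filter, hq.finrank_eq, lt_min_iff]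
  simp only [Finset.mem_univ, j.2, and_true, true_and]
  constructor
  · intro h
    by_contra! hij
    exact h (inf_le_left.trans (hq.mono hij))
  · intro h h'
    rw [inf_eq_right.2 (hq.mono h)] at h'
    have := Submodule.finrank_mono h'
    rw [hq.finrank_eq, hq.finrank_eq] at this
    omega

theorem IsCompleteFlag.position_jumps_eq_level {q : ℕ → SubLattice K n} (hq : IsCompleteFlag q)
    {x : OrthoComplex K n} (hx : x ∈ subcomplex (Set.range q)) :
    position (jumps q) x.weight = level x := by
  rw [level_eq_position]
  ext j
  rw [position_apply, position_apply]
  refine Finset.sum_congr rfl fun p hp => ?_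
  obtain ⟨i, rfl⟩ := hx hp
  rw [hq.jumps_apply]

/-- For `p` in the support, the indices in `jumps q p` carry strictly larger coordinates than the
others. If the coordinates are nonincreasing, then `jumps q p` is an initial segment, which means
that `p` lies inside the flag member of its own dimension and equals it. -/
theorem IsCompleteFlag.mem_range_of_antitone {q : ℕ → SubLattice K n} (hq : IsCompleteFlag q)
    {y : OrthoComplex K n} (hy : Antitone (position (jumps q) y.weight)) :
    y ∈ subcomplex (Set.range q) := by
  intro p hp
  have hJ := hq.isRankMap_jumps
  have hp0 : 0 < y.weight p :=
    lt_of_le_of_ne (y.nonneg p) (Finsupp.mem_support_iff.1 hp).symm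
  -- The subspace `p` contributes to `j` and not to `i`. No other `r` of the support reverses this:
  -- above `p` it contributes to `j`, and below `p` it does not contribute to `i`.
  have hlt : ∀ i j : Fin n, i ∉ jumps q p → j ∈ jumps q p →
      position (jumps q) y.weight i < position (jumps q) y.weight j := by
    intro i j hi hj
    rw [position_apply, position_apply]
    refine Finset.sum_lt_sum (fun r hr => ?_) ⟨p, hp, by simp [hi, hj, hp0]⟩
    rcases y.isChain.total hp hr with h | h
    · rw [if_pos (hJ.mono h hj)]
      split_ifs
      exacts [le_rfl, y.nonneg r]
    · rw [if_neg fun hr => hi (hJ.mono h hr)]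
      split_ifs
      exacts [y.nonneg r, le_rfl]
  have hdown : ∀ i j : Fin n, i ≤ j → j ∈ jumps q p → i ∈ jumps q p := fun i j hij hj =>
    by_contra fun hi => (hlt i j hi hj).not_ge (hy hij)
  have hsub : ∀ j ∈ jumps q p, (j : ℕ) < Module.finrank K p := by
    intro j hj
    have h1 : Finset.Iic j ⊆ jumps q p := fun i hi => hdown i j (Finset.mem_Iic.1 hi) hj
    have h2 := Finset.card_le_card h1
    rw [Fin.card_Iic, hJ.card] at h2
    omega
  refine ⟨Module.finrank K p, ?_⟩
  have h1 := hq.card_filter_jumps p (finrank_le p)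
  rw [Finset.filter_true_of_mem hsub, hJ.card] at h1
  have h2 : p ⊓ q (Module.finrank K p) = p := eq_of_le_of_finrank_le inf_le_left h1.le
  refine (eq_of_le_of_finrank_le (inf_eq_left.1 h2) ?_).symm
  rw [hq.finrank_eq]
  exact min_le_left _ _

/-! ### Uniqueness of the minimizer -/

/-- In a nonzero difference of weights, the largest subspace `p` of the support alone meets the last
coordinate that sees it. If `p` has dimension zero, it is the whole support and is excluded because
both total masses are 1. -/
theorem eq_of_level_eq {C : Set (SubLattice K n)} (hC : IsChain (· ≤ ·) C) {x y : OrthoComplex K n}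
    (hx : x ∈ subcomplex C) (hy : y ∈ subcomplex C) (h : level x = level y) : x = y := by
  classical
  have hchain := isChain_support_sub hC hx hy
  obtain ⟨v, hv⟩ : ∃ v, v = x.weight - y.weight := ⟨_, rfl⟩
  have hpos : position initialSegment v = 0 := by
    rw [hv, position_sub, ← level_eq_position, ← level_eq_position, h, sub_self]
  have hsum : v.sum (fun _ w => w) = 0 := by
    rw [hv, Finsupp.sum_sub_index (h := fun (_ : SubLattice K n) (w : ℝ) => w) fun _ _ _ => rfl]
    exact sub_eq_zero.2 (x.sum_eq_one.trans y.sum_eq_one.symm)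
  rw [← hv] at hchain
  have hv0 : v = 0 := by
    by_contra hne
    obtain ⟨p, hp, hmax⟩ := Finset.exists_maximalFor (fun p : SubLattice K n => Module.finrank K p) v.support
      (Finsupp.support_nonempty_iff.2 hne)
    have hmax' : ∀ r ∈ v.support, r ≠ p → Module.finrank K r < Module.finrank K p := by
      intro r hr hrp
      rcases hchain.total hr hp with h | h
      · exact Submodule.finrank_lt_finrank_of_lt (lt_of_le_of_ne h hrp)
      · exact absurd (eq_of_le_of_finrank_le h (hmax hr (Submodule.finrank_mono h))) hrp.symm
    have hvp := Finsupp.mem_support_iff.1 hp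
    rcases Nat.eq_zero_or_pos (Module.finrank K p) with h0 | h0
    · have hsub : v.support = {p} := by
        refine Finset.eq_singleton_iff_unique_mem.2 ⟨hp, fun r hr => ?_⟩
        by_contra hrp
        have := hmax' r hr hrp
        omega
      rw [Finsupp.sum, hsub, Finset.sum_singleton] at hsum
      exact hvp hsum
    · have hlt : Module.finrank K p - 1 < n := by
        have := finrank_le p
        omega
      -- Coordinates are counted from 0, so the last one to which `p` contributes has index `finrank
      -- p - 1`; smaller subspaces do not reach it.
      have h1 := congrFun (congrArg WithLp.ofLp hpos) ⟨Module.finrank K p - 1, hlt⟩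
      rw [position_apply, Finset.sum_eq_single_of_mem p hp] at h1
      · rw [if_pos (by simp [initialSegment, h0])] at h1
        exact hvp h1
      · intro r hr hrp
        have := hmax' r hr hrp
        refine if_neg ?_
        simp only [initialSegment, Finset.mem_filter, Finset.mem_univ, true_and]
        omega
  rw [hv0] at hv
  exact OrthoComplex.ext (sub_eq_zero.1 hv.symm)

theorem IsResolvent.eq {c lam : ℝ} (hc : 0 < c) (hlam : 0 < lam) {x y y' : OrthoComplex K n}
    (h : InCommonSimplex x y) (hy : ∀ j, level y j = coordResolvent c lam (level x j))
    (hy' : IsResolvent (objective c) lam x y') : y' = y := by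
  obtain ⟨C, hC, hxC, hyC⟩ := h
  obtain ⟨q, hq, rfl⟩ := IsMaxChain.exists_isCompleteFlag hC
  have hpos := hy'.position_eq hc hlam ⟨_, hC, hxC, hyC⟩ hy hq.isRankMap_jumps
    (hq.position_jumps_eq_level hxC)
  -- Standard coordinates are nonincreasing because their index sets are initial segments, and the
  -- monotone one-variable resolvent preserves this.
  have hanti : Antitone (level y) := by
    intro i j hij
    rw [hy, hy]
    refine coordResolvent_mono hc hlam ?_
    rw [level_eq_position, position_apply, position_apply]
    refine Finset.sum_le_sum fun p _ => ?_
    by_cases h2 : j ∈ initialSegment p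
    · have h1 : i ∈ initialSegment p := by
        simp only [initialSegment, Finset.mem_filter, Finset.mem_univ, true_and] at h2 ⊢
        exact lt_of_le_of_lt hij h2
      rw [if_pos h1, if_pos h2]
    · rw [if_neg h2]
      split_ifs
      exacts [x.nonneg p, le_rfl]
  have hyq' : y' ∈ subcomplex (Set.range q) := hq.mem_range_of_antitone (by rwa [hpos])
  exact eq_of_level_eq hC.1 hyq' hyC ((hq.position_jumps_eq_level hyq').symm.trans hpos)

/-! ## Frames -/

/-- Refine the chain to a complete flag and choose one vector in each step of the flag. The lines
they span form a base, and every member of the flag is the join of the first few of them. -/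
theorem exists_isBase_subset_frame {C : Set (SubLattice K n)} (hC : IsChain (· ≤ ·) C) :
    ∃ a : Fin n → SubLattice K n, IsBase a ∧ C ⊆ frame a := by
  obtain ⟨q, hq, hCq, -⟩ := exists_isCompleteFlag hC
  have hv : ∀ j : Fin n, ∃ v ∈ q (j + 1), v ∉ q j := by
    intro j
    by_contra! h
    have := Submodule.finrank_mono (show q (j + 1) ≤ q j from h)
    rw [hq.finrank_eq, hq.finrank_eq] at this
    omega
  choose v hv1 hv2 using hv
  -- By induction on `i`: the join of the first `i` lines lies in `q i`, and each new vector lies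
  -- outside the previous join, so the dimensions agree.
  have hsup : ∀ i ≤ n, ⨆ j ∈ Finset.univ.filter (fun j : Fin n => (j : ℕ) < i),
      Submodule.span K {v j} = q i := by
    intro i hi
    have hle : ⨆ j ∈ Finset.univ.filter (fun j : Fin n => (j : ℕ) < i),
        Submodule.span K {v j} ≤ q i := by
      refine iSup₂_le fun j hj => ?_
      rw [Submodule.span_singleton_le_iff_mem]
      exact hq.mono (Finset.mem_filter.1 hj).2 (hv1 j)
    induction i with
    | zero =>
      refine eq_of_le_of_finrank_le hle ?_
      rw [hq.finrank_eq]
      simp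
    | succ i ih =>
      have hle' : ⨆ j ∈ Finset.univ.filter (fun j : Fin n => (j : ℕ) < i),
          Submodule.span K {v j} ≤ q i := by
        refine iSup₂_le fun j hj => ?_
        rw [Submodule.span_singleton_le_iff_mem]
        exact hq.mono (Finset.mem_filter.1 hj).2 (hv1 j)
      have ih' := ih (Nat.le_of_succ_le hi) hle'
      have h1 : q i ≤ ⨆ j ∈ Finset.univ.filter (fun j : Fin n => (j : ℕ) < i + 1),
          Submodule.span K {v j} := by
        rw [← ih']
        refine biSup_mono fun j hj => ?_
        simp only [Finset.mem_filter, Finset.mem_univ, true_and] at hj ⊢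
        omega
      have h2 : v ⟨i, hi⟩ ∈ ⨆ j ∈ Finset.univ.filter (fun j : Fin n => (j : ℕ) < i + 1),
          Submodule.span K {v j} := by
        refine (le_iSup₂_of_le (f := fun (j : Fin n)
          (_ : j ∈ Finset.univ.filter (fun j : Fin n => (j : ℕ) < i + 1)) =>
          Submodule.span K {v j}) ⟨i, hi⟩ (by simp) le_rfl)
          (Submodule.mem_span_singleton_self _)
      have h3 := Submodule.finrank_lt_finrank_of_lt
        (lt_of_le_of_ne h1 fun h => hv2 ⟨i, hi⟩ (by rw [← h] at h2; exact h2))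
      refine eq_of_le_of_finrank_le hle ?_
      rw [hq.finrank_eq] at h3 ⊢
      omega
  have htop : q n = ⊤ := by
    apply Submodule.eq_top_of_finrank_eq
    rw [hq.finrank_eq]
    simp
  refine ⟨fun j => Submodule.span K {v j}, ⟨fun j => ?_, ?_⟩, fun p hp => ?_⟩
  · refine nonzero_span_atom _ fun h => hv2 j ?_
    rw [h]
    exact zero_mem _
  · rw [← htop, ← hsup n le_rfl]
    simp
  · obtain ⟨i, rfl⟩ := hCq hp
    -- The flag is indexed by all natural numbers and is constant from `n` on, so indices are cut
    -- down to at most `n`.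
    have hqi : q (min i n) = q i :=
      eq_of_le_of_finrank_le (hq.mono (min_le_left _ _)) (by simp [hq.finrank_eq])
    exact ⟨_, (hsup (min i n) (min_le_right _ _)).trans hqi⟩

/-! ## Construction of the resolvent -/

section

open Classical in
/-- The weights of the point obtained by applying `φ` to all coordinates. -/
noncomputable def mapWeight (φ : ℝ → ℝ) (x : OrthoComplex K n) (p : SubLattice K n) : ℝ :=
  (if p = ⊥ then 1 else φ (∑ r ∈ x.weight.support with p ≤ r, x.weight r)) -
    if p = ⊤ then 0 else φ (∑ r ∈ x.weight.support with p < r, x.weight r)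

open Classical in
/-- The support of `x` together with the minimum and the maximum. -/
noncomputable def extendedSupport (x : OrthoComplex K n) : Finset (SubLattice K n) :=
  insert ⊥ (insert ⊤ x.weight.support)

theorem isChain_extendedSupport (x : OrthoComplex K n) :
    IsChain (· ≤ ·) (extendedSupport x : Set (SubLattice K n)) := by
  rw [extendedSupport, Finset.coe_insert, Finset.coe_insert]
  exact (x.isChain.insert fun _ _ _ => Or.inr le_top).insert fun _ _ _ => Or.inl bot_le

theorem mem_extendedSupport {x : OrthoComplex K n} {p : SubLattice K n} :
    p ∈ extendedSupport x ↔ p = ⊥ ∨ p = ⊤ ∨ p ∈ x.weight.support := by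
  simp [extendedSupport]

/-- Outside the support, the masses at or above `p` and strictly above `p` coincide, so their
transformed values cancel. -/
theorem mapWeight_eq_zero {φ : ℝ → ℝ} {x : OrthoComplex K n} {p : SubLattice K n}
    (hp : p ∉ extendedSupport x) : mapWeight φ x p = 0 := by
  classical
  simp only [mem_extendedSupport, not_or] at hp
  rw [mapWeight, if_neg hp.1, if_neg hp.2.1, sub_eq_zero]
  congr 1
  refine Finset.sum_congr (Finset.filter_congr fun r hr => ⟨fun h => lt_of_le_of_ne h ?_, le_of_lt⟩)
    fun _ _ => rfl
  rintro rfl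
  exact hp.2.2 hr

theorem mapWeight_nonneg {φ : ℝ → ℝ} (hφ : Monotone φ) (hφ' : ∀ t, φ t ∈ Set.Icc (0 : ℝ) 1)
    (x : OrthoComplex K n) (p : SubLattice K n) : 0 ≤ mapWeight φ x p := by
  classical
  rw [mapWeight, sub_nonneg]
  split_ifs
  · exact zero_le_one
  · exact (hφ' _).1
  · exact (hφ' _).2
  · refine hφ (Finset.sum_le_sum_of_subset_of_nonneg ?_ fun r _ _ => x.nonneg r)
    exact Finset.monotone_filter_right _ fun r _ h => h.le

-- Telescoping along the chain: the weight of the least member `p` satisfying `P` is its own tail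
-- value minus the value of the tail strictly above it, and the latter is the sum over the remaining
-- members by induction. The prescribed values 1 at the bottom and 0 beyond the top make the total
-- mass 1, whatever `φ` is.
open Classical in
theorem sum_mapWeight (φ : ℝ → ℝ) (x : OrthoComplex K n) {P : SubLattice K n → Prop}
    (hP : ∀ p r, p ≤ r → P p → P r) (htop : P ⊤) :
    ∑ p ∈ extendedSupport x with P p, mapWeight φ x p =
      if P ⊥ then 1 else φ (∑ r ∈ x.weight.support with P r, x.weight r) := by
  induction hm : (Finset.filter P (extendedSupport x)).card using Nat.strong_induction_on
    generalizing P with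
  | _ m ih =>
    subst hm
    have hne : (Finset.filter P (extendedSupport x)).Nonempty :=
      ⟨⊤, Finset.mem_filter.2 ⟨mem_extendedSupport.2 (Or.inr (Or.inl rfl)), htop⟩⟩
    obtain ⟨p, hp, hmin⟩ := Finset.exists_minimal hne
    obtain ⟨hpE, hPp⟩ := Finset.mem_filter.1 hp
    have hmin' : ∀ r ∈ extendedSupport x, P r ↔ p ≤ r := by
      refine fun r hr => ⟨fun h => ?_, fun h => hP _ _ h hPp⟩
      rcases (isChain_extendedSupport x).total hpE hr with h' | h'
      · exact h'
      · exact hmin (Finset.mem_filter.2 ⟨hr, h⟩) h'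
    have hbot : P ⊥ ↔ p = ⊥ := by
      rw [hmin' _ (mem_extendedSupport.2 (Or.inl rfl)), le_bot_iff]
    have hsupp : Finset.filter P x.weight.support = Finset.filter (p ≤ ·) x.weight.support :=
      Finset.filter_congr fun r hr => hmin' r (mem_extendedSupport.2 (Or.inr (Or.inr hr)))
    rw [hsupp, Finset.filter_congr hmin']
    have hsplit : ∑ r ∈ extendedSupport x with p ≤ r, mapWeight φ x r =
        mapWeight φ x p + ∑ r ∈ extendedSupport x with p < r, mapWeight φ x r := by
      rw [← Finset.sum_insert (by simp)]
      refine Finset.sum_congr ?_ fun _ _ => rfl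
      ext r
      simp only [Finset.mem_filter, Finset.mem_insert, le_iff_eq_or_lt]
      constructor
      · rintro ⟨h1, rfl | h2⟩
        exacts [Or.inl rfl, Or.inr ⟨h1, h2⟩]
      · rintro (rfl | ⟨h1, h2⟩)
        exacts [⟨hpE, Or.inl rfl⟩, ⟨h1, Or.inr h2⟩]
    rw [hsplit, mapWeight]
    simp only [hbot]
    by_cases hpt : p = ⊤
    · simp [hpt]
    · have hcard : (Finset.filter (p < ·) (extendedSupport x)).card <
          (Finset.filter P (extendedSupport x)).card := by
        refine Finset.card_lt_card ((Finset.ssubset_iff_of_subset ?_).2 ⟨p, hp, by simp⟩)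
        exact Finset.monotone_filter_right _ fun r _ h => hP _ _ h.le hPp
      -- The upper set is replaced by the one strictly above `p`. It contains `⊤` because `p ≠ ⊤`,
      -- and it does not contain `⊥`.
      rw [ih _ hcard (P := (p < ·)) (fun _ _ h h' => lt_of_lt_of_le h' h)
        (lt_top_iff_ne_top.2 hpt) rfl]
      simp [hpt]

/-- The point obtained by applying `φ` to all coordinates. -/
noncomputable def mapCoord (φ : ℝ → ℝ) (hφ : Monotone φ) (hφ' : ∀ t, φ t ∈ Set.Icc (0 : ℝ) 1)
    (x : OrthoComplex K n) : OrthoComplex K n where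
  weight := Finsupp.onFinset (extendedSupport x) (mapWeight φ x) fun p hp => by
    by_contra h
    exact hp (mapWeight_eq_zero h)
  nonneg p := mapWeight_nonneg hφ hφ' x p
  sum_eq_one := by
    classical
    have h := sum_mapWeight φ x (P := fun _ => True) (fun _ _ _ _ => trivial) trivial
    rw [if_pos trivial, Finset.filter_true] at h
    refine Eq.trans (Finset.sum_subset Finsupp.support_onFinset_subset fun p _ hp => ?_) h
    exact Finsupp.notMem_support_iff.1 hp
  isChain := (isChain_extendedSupport x).mono
    (Finset.coe_subset.2 Finsupp.support_onFinset_subset)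

variable {φ : ℝ → ℝ} (hφ : Monotone φ) (hφ' : ∀ t, φ t ∈ Set.Icc (0 : ℝ) 1)

theorem supp_mapCoord_subset (x : OrthoComplex K n) :
    (mapCoord φ hφ hφ' x).supp ⊆ extendedSupport x := by
  intro p hp
  by_contra h
  exact Finsupp.mem_support_iff.1 hp (mapWeight_eq_zero h)

-- Both kinds of coordinates are masses of upper sets that contain `⊤` but not `⊥`: subspaces of
-- dimension above `j`, or subspaces containing the atom `a i`. One computation therefore serves
-- both.
open Classical in
theorem sum_mapCoord_weight (x : OrthoComplex K n) {P : SubLattice K n → Prop}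
    (hP : ∀ p r, p ≤ r → P p → P r) (htop : P ⊤) (hbot : ¬ P ⊥) :
    (∑ p ∈ (mapCoord φ hφ hφ' x).weight.support,
      if P p then (mapCoord φ hφ hφ' x).weight p else 0) =
      φ (∑ p ∈ x.weight.support, if P p then x.weight p else 0) := by
  have h := sum_mapWeight φ x hP htop
  rw [if_neg hbot, Finset.sum_filter, Finset.sum_filter] at h
  rw [← h]
  refine Finset.sum_subset (supp_mapCoord_subset hφ hφ' x) fun p _ hp => ?_
  rw [Finsupp.notMem_support_iff.1 hp, ite_self]

theorem level_mapCoord (x : OrthoComplex K n) (j : Fin n) :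
    level (mapCoord φ hφ hφ' x) j = φ (level x j) := by
  have h := sum_mapCoord_weight hφ hφ' x (P := fun p => (j : ℕ) < Module.finrank K p)
    (fun p r hpr hp => hp.trans_le (Submodule.finrank_mono hpr)) (by simp) (by simp)
  simp only [level]
  convert h

theorem frameCoord_mapCoord {a : Fin n → SubLattice K n} (ha : IsBase a) (x : OrthoComplex K n)
    (i : Fin n) : frameCoord a (mapCoord φ hφ hφ' x) i = φ (frameCoord a x i) :=
  sum_mapCoord_weight hφ hφ' x (P := fun p => a i ≤ p) (fun _ _ hpr hp => hp.trans hpr) le_top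
    fun h => (ha.1 i).1 (le_bot_iff.1 h)

/-- Only `⊥` and `⊤` can be new in the support, so the statement covers maximal chains and frames
alike. -/
theorem mapCoord_mem_subcomplex {S : Set (SubLattice K n)} {x : OrthoComplex K n}
    (hx : x ∈ subcomplex S) (hbot : ⊥ ∈ S) (htop : ⊤ ∈ S) :
    mapCoord φ hφ hφ' x ∈ subcomplex S := by
  intro p hp
  rcases mem_extendedSupport.1 (supp_mapCoord_subset hφ hφ' x hp) with rfl | rfl | h
  exacts [hbot, htop, hx h]

theorem inCommonSimplex_mapCoord (x : OrthoComplex K n) :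
    InCommonSimplex x (mapCoord φ hφ hφ' x) := by
  obtain ⟨C, hC, hx⟩ := x.isChain.exists_maxChain
  exact ⟨C, hC, hx, mapCoord_mem_subcomplex hφ hφ' hx hC.bot_mem hC.top_mem⟩

end

theorem bot_mem_frame (a : Fin n → SubLattice K n) : ⊥ ∈ frame a := ⟨∅, by simp⟩

theorem top_mem_frame {a : Fin n → SubLattice K n} (ha : IsBase a) : ⊤ ∈ frame a :=
  ⟨Finset.univ, by simpa using ha.2⟩

/-- The resolvent, which is computed by `coordResolvent` in every coordinate. -/
noncomputable def resolvent {c lam : ℝ} (hc : 0 < c) (hlam : 0 < lam) (x : OrthoComplex K n) :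
    OrthoComplex K n :=
  mapCoord (coordResolvent c lam) (coordResolvent_mono hc hlam) (coordResolvent_mem_Icc c lam) x

theorem isResolvent_resolvent {c lam : ℝ} (hc : 0 < c) (hlam : 0 < lam) (x : OrthoComplex K n) :
    IsResolvent (objective c) lam x (resolvent hc hlam x) :=
  isResolvent_of_level_eq hc hlam (inCommonSimplex_mapCoord _ _ x) (level_mapCoord _ _ x)

theorem exists_resolvent (K : Type u) [Field K] (n : ℕ) (c lam : ℝ) (hc : 0 < c) (hlam : 0 < lam)
    (x₀ : OrthoComplex K n) : ∃ y : OrthoComplex K n,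
      IsResolvent (objective c) lam x₀ y ∧
      (∀ y', IsResolvent (objective c) lam x₀ y' → y' = y) ∧
      (∀ C : Set (SubLattice K n), IsMaxChain (· ≤ ·) C → x₀ ∈ subcomplex C → y ∈ subcomplex C) ∧
      (∃ a : Fin n → SubLattice K n, IsBase a ∧ x₀ ∈ subcomplex (frame a)) ∧
      (∀ a : Fin n → SubLattice K n, IsBase a → x₀ ∈ subcomplex (frame a) →
        y ∈ subcomplex (frame a) ∧
        ∀ i : Fin n,
          frameCoord a y i ∈ Set.Icc (0 : ℝ) 1 ∧
          IsMinOn (fun t : ℝ => -t + c * t ^ 2 + 1 / (2 * lam) * (t - frameCoord a x₀ i) ^ 2)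
            (Set.Icc 0 1) (frameCoord a y i) ∧
          frameCoord a y i =
            max 0 (min 1 ((frameCoord a x₀ i + lam) / (1 + 2 * c * lam)))) := by
  refine ⟨resolvent hc hlam x₀, isResolvent_resolvent hc hlam x₀, fun y' hy' => ?_,
    fun C hC hx => ?_, exists_isBase_subset_frame x₀.isChain, fun a ha hx => ⟨?_, fun i => ?_⟩⟩
  · exact hy'.eq hc hlam (inCommonSimplex_mapCoord _ _ x₀) (level_mapCoord _ _ x₀)
  · exact mapCoord_mem_subcomplex _ _ hx hC.bot_mem hC.top_mem
  · exact mapCoord_mem_subcomplex _ _ hx (bot_mem_frame a) (top_mem_frame ha)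
  · have h : frameCoord a (resolvent hc hlam x₀) i = coordResolvent c lam (frameCoord a x₀ i) :=
      frameCoord_mapCoord _ _ ha x₀ i
    rw [h]
    exact ⟨coordResolvent_mem_Icc _ _ _, isMinOn_coordResolvent hc hlam _, rfl⟩

end Orthoscheme

/-! ### The program and its running time -/

namespace FieldRAM

variable {K : Type u}

/-! ## Memory access -/

theorem int_writeInt_same (s : State K) (a i : ℕ) (z : ℤ) :
    (s.writeInt a i z).int a = Function.update (s.int a) i z := by
  simp [State.writeInt]

theorem int_writeInt_of_ne (s : State K) {a b : ℕ} (h : b ≠ a) (i : ℕ) (z : ℤ) :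
    (s.writeInt a i z).int b = s.int b := by
  simp [State.writeInt, h]

theorem fld_writeInt (s : State K) (a i : ℕ) (z : ℤ) : (s.writeInt a i z).fld = s.fld := rfl

theorem fld_writeFld_same (s : State K) (a i : ℕ) (z : K) :
    (s.writeFld a i z).fld a = Function.update (s.fld a) i z := by
  simp [State.writeFld]

theorem fld_writeFld_of_ne (s : State K) {a b : ℕ} (h : b ≠ a) (i : ℕ) (z : K) :
    (s.writeFld a i z).fld b = s.fld b := by
  simp [State.writeFld, h]

/-! ## Bit lengths -/

theorem bits_le_iff {z : ℤ} {k : ℕ} : bits z ≤ k ↔ z.natAbs < 2 ^ k := Nat.size_le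

theorem natAbs_lt_two_pow_bits (z : ℤ) : z.natAbs < 2 ^ bits z := bits_le_iff.1 le_rfl

theorem bits_zero : bits 0 = 0 := by decide

theorem bits_one : bits 1 = 1 := by decide

theorem bits_two : bits 2 = 2 := by decide

theorem bits_mono {y z : ℤ} (hy : 0 ≤ y) (h : y ≤ z) : bits y ≤ bits z :=
  Nat.size_le_size (by omega)

theorem bits_natCast_le (k : ℕ) : bits (k : ℤ) ≤ k :=
  bits_le_iff.2 (by simpa using Nat.lt_two_pow_self)

theorem bits_natCast_le_of_le {k l : ℕ} (h : k ≤ l) : bits (k : ℤ) ≤ l :=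
  (bits_natCast_le k).trans h

theorem bits_mul_le (y z : ℤ) : bits (y * z) ≤ bits y + bits z := by
  rw [bits_le_iff, Int.natAbs_mul, pow_add]
  exact Nat.mul_lt_mul'' (natAbs_lt_two_pow_bits y) (natAbs_lt_two_pow_bits z)

theorem bits_add_le_of_natAbs_le {x y z : ℤ} (h : x.natAbs ≤ y.natAbs + z.natAbs) :
    bits x ≤ max (bits y) (bits z) + 1 := by
  rw [bits_le_iff, pow_succ]
  have h1 := (natAbs_lt_two_pow_bits y).trans_le
    (Nat.pow_le_pow_right two_pos (le_max_left (bits y) (bits z)))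
  have h2 := (natAbs_lt_two_pow_bits z).trans_le
    (Nat.pow_le_pow_right two_pos (le_max_right (bits y) (bits z)))
  omega

theorem bits_add_le (y z : ℤ) : bits (y + z) ≤ max (bits y) (bits z) + 1 :=
  bits_add_le_of_natAbs_le (Int.natAbs_add_le y z)

theorem bits_sub_le (y z : ℤ) : bits (y - z) ≤ max (bits y) (bits z) + 1 :=
  bits_add_le_of_natAbs_le (Int.natAbs_sub_le y z)

/-! ## Costs of expressions whose leaves have few bits -/

/-- The number of nodes of an integer expression. -/
def IExp.size : IExp → ℕ
  | .const _ => 1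
  | .get _ i => 1 + i.size
  | .add e f => 1 + e.size + f.size
  | .sub e f => 1 + e.size + f.size
  | .mul e f => 1 + e.size + f.size

/-- All constants of an expression, and all integers it reads, have at most `β` bits. -/
def IExp.Small (s : State K) (β : ℕ) : IExp → Prop
  | .const z => bits z ≤ β
  | .get a i => i.Small s β ∧ bits (s.int a (i.eval s).toNat) ≤ β
  | .add e f => e.Small s β ∧ f.Small s β
  | .sub e f => e.Small s β ∧ f.Small s β
  | .mul e f => e.Small s β ∧ f.Small s β

/-- A product adds the lengths of its factors, and a sum needs one bit more than its longer term.
That bit is paid for by the node of the sum itself, as `1 ≤ β`. -/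
theorem IExp.bits_eval_le {s : State K} {β : ℕ} (hβ : 1 ≤ β) {e : IExp} (h : e.Small s β) :
    bits (e.eval s) ≤ e.size * β := by
  induction e with
  | const z =>
    simp only [IExp.size, IExp.eval, one_mul]
    exact h
  | get a i _ => exact h.2.trans (Nat.le_mul_of_pos_left _ (by simp [IExp.size]))
  | add e f ihe ihf =>
    have h1 := ihe h.1
    have h2 := ihf h.2
    have h3 := bits_add_le (e.eval s) (f.eval s)
    simp only [IExp.size, IExp.eval, add_mul]
    omega
  | sub e f ihe ihf =>
    have h1 := ihe h.1
    have h2 := ihf h.2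
    have h3 := bits_sub_le (e.eval s) (f.eval s)
    simp only [IExp.size, IExp.eval, add_mul]
    omega
  | mul e f ihe ihf =>
    have h1 := ihe h.1
    have h2 := ihf h.2
    have h3 := bits_mul_le (e.eval s) (f.eval s)
    simp only [IExp.size, IExp.eval, add_mul]
    omega

theorem cost_node_le {x y a b β k : ℕ} (hx : x ≤ a * (1 + a * β)) (hy : y ≤ b * (1 + b * β))
    (hk : k ≤ (1 + a + b) * β) :
    1 + x + y + k ≤ (1 + a + b) * (1 + (1 + a + b) * β) := by
  have h1 : (1 + a + b) * (1 + (1 + a + b) * β) = 1 + a * (1 + a * β) + b * (1 + b * β) +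
      (1 + a + b) * β + (a + b + 2 * a * b) * β := by ring
  omega

theorem IExp.cost_le {s : State K} {β : ℕ} (hβ : 1 ≤ β) {e : IExp} (h : e.Small s β) :
    e.cost s ≤ e.size * (1 + e.size * β) := by
  induction e with
  | const z =>
    simp only [IExp.cost, IExp.size, one_mul]
    exact Nat.add_le_add_left h 1
  | get a i ih =>
    have := cost_node_le (b := 0) (y := 0) (ih h.1) (by simp) (IExp.bits_eval_le hβ h)
    simpa [IExp.cost, IExp.size] using this
  | add e f ihe ihf => exact cost_node_le (ihe h.1) (ihf h.2) (IExp.bits_eval_le hβ h)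
  | sub e f ihe ihf => exact cost_node_le (ihe h.1) (ihf h.2) (IExp.bits_eval_le hβ h)
  | mul e f ihe ihf => exact cost_node_le (ihe h.1) (ihf h.2) (IExp.bits_eval_le hβ h)

/-! ## Total correctness with time bounds -/

/-- A bound for the time of an elementary step with at most 40 nodes. -/
def stepTime (β : ℕ) : ℕ := 1700 * (1 + β)

theorem cost_pair_le {x y a b β : ℕ} (hx : x ≤ a * (1 + a * β)) (hy : y ≤ b * (1 + b * β))
    (hab : a + b ≤ 40) : 1 + x + y ≤ stepTime β := by
  have h := cost_node_le hx hy (Nat.zero_le _)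
  -- At most 40 nodes, and one for the instruction itself; the constant 1700 in `stepTime` exceeds
  -- `41 ^ 2 = 1681`.
  have h1 : (1 + a + b) * (1 + (1 + a + b) * β) ≤ 41 * (1 + 41 * β) := by
    gcongr <;> omega
  unfold stepTime
  omega

theorem test_lt_cost_le {s : State K} {β : ℕ} (hβ : 1 ≤ β) {e f : IExp} (he : e.Small s β) (hf : f.Small s β)
    (hsize : e.size + f.size ≤ 40) : (Test.lt e f).cost s ≤ stepTime β :=
  cost_pair_le (e.cost_le hβ he) (f.cost_le hβ hf) hsize

variable [Field K]

/-- Started in `s`, the program `P` halts in a state with the property `Q`, within the time of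
`k` elementary steps. -/
def Runs (β : ℕ) (P : Prog) (s : State K) (k : ℕ) (Q : State K → Prop) : Prop :=
  ∃ t s', Exec P s t s' ∧ t ≤ k * stepTime β ∧ Q s'

variable {β : ℕ} {s : State K} {P P' : Prog} {k k' : ℕ} {Q R : State K → Prop}

theorem Runs.mono (h : Runs β P s k Q) (hk : k ≤ k') (hQ : ∀ s', Q s' → R s') :
    Runs β P s k' R := by
  obtain ⟨t, s', h1, h2, h3⟩ := h
  exact ⟨t, s', h1, h2.trans (Nat.mul_le_mul_right _ hk), hQ s' h3⟩

theorem Runs.seq (h : Runs β P s k Q) (h' : ∀ s', Q s' → Runs β P' s' k' R) :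
    Runs β (.seq P P') s (k + k') R := by
  obtain ⟨t, s', h1, h2, h3⟩ := h
  obtain ⟨t', s'', h1', h2', h3'⟩ := h' s' h3
  exact ⟨t + t', s'', .seq h1 h1', by rw [add_mul]; omega, h3'⟩

theorem Runs.skip (h : Q s) : Runs β .skip s 1 Q :=
  ⟨1, s, .skip s, by unfold stepTime; omega, h⟩

theorem Runs.setInt (hβ : 1 ≤ β) {a : ℕ} {i e : IExp} (hi : i.Small s β) (he : e.Small s β)
    (hsize : i.size + e.size ≤ 40) (h : Q (s.writeInt a (i.eval s).toNat (e.eval s))) :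
    Runs β (.setInt a i e) s 1 Q := by
  refine ⟨_, _, .setInt a i e s, ?_, h⟩
  rw [one_mul]
  exact cost_pair_le (i.cost_le hβ hi) (e.cost_le hβ he) hsize

theorem Runs.setInt_seq (hβ : 1 ≤ β) {a : ℕ} {i e : IExp} (hi : i.Small s β) (he : e.Small s β)
    (hsize : i.size + e.size ≤ 40)
    (h : Runs β P (s.writeInt a (i.eval s).toNat (e.eval s)) k R) :
    Runs β (.seq (.setInt a i e) P) s (1 + k) R :=
  Runs.seq (Q := fun s' => Runs β P s' k R) (.setInt hβ hi he hsize h) fun _ h' => h'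

theorem Runs.setFld (hβ : 1 ≤ β) {a : ℕ} {i : IExp} {e : FExp} (hi : i.Small s β)
    (he : e.cost s ≤ 20 * (1 + 20 * β)) (hsize : i.size ≤ 20)
    (h : Q (s.writeFld a (i.eval s).toNat (e.eval s))) :
    Runs β (.setFld a i e) s 1 Q := by
  refine ⟨_, _, .setFld a i e s, ?_, h⟩
  rw [one_mul]
  exact cost_pair_le (i.cost_le hβ hi) he (by omega)

theorem Runs.ite (hβ : 1 ≤ β) {e f : IExp} (he : e.Small s β) (hf : f.Small s β)
    (hsize : e.size + f.size ≤ 40) (h1 : e.eval s < f.eval s → Runs β P s k Q)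
    (h2 : ¬ e.eval s < f.eval s → Runs β P' s k Q) :
    Runs β (.ite (.lt e f) P P') s (1 + k) Q := by
  have hc := test_lt_cost_le hβ he hf hsize
  by_cases hb : e.eval s < f.eval s
  · obtain ⟨t, s', h3, h4, h5⟩ := h1 hb
    exact ⟨_, s', .ite_true hb h3, by rw [add_mul]; omega, h5⟩
  · obtain ⟨t, s', h3, h4, h5⟩ := h2 hb
    exact ⟨_, s', .ite_false hb h3, by rw [add_mul]; omega, h5⟩

theorem Runs.loop (hβ : 1 ≤ β) {e f : IExp} (N : ℕ) (I : ℕ → State K → Prop) (h0 : I 0 s)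
    (hsmall : ∀ i ≤ N, ∀ s', I i s' → e.Small s' β ∧ f.Small s' β)
    (hsize : e.size + f.size ≤ 40)
    (hstep : ∀ i < N, ∀ s', I i s' → e.eval s' < f.eval s' ∧ Runs β P s' k (I (i + 1)))
    (hend : ∀ s', I N s' → ¬ e.eval s' < f.eval s') :
    Runs β (.loop (.lt e f) P) s (N * (k + 1) + 1) (I N) := by
  -- Induction on the number `j` of rounds that remain; the extra 1 in the bound is the final
  -- failing test.
  suffices h : ∀ j ≤ N, ∀ s', I (N - j) s' →
      Runs β (.loop (.lt e f) P) s' (j * (k + 1) + 1) (I N) by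
    exact h N le_rfl s (by rwa [Nat.sub_self])
  intro j
  induction j with
  | zero =>
    intro _ s' hs'
    have hc := hsmall N le_rfl s' hs'
    refine ⟨_, s', .loop_done (hend s' hs'), ?_, hs'⟩
    have := test_lt_cost_le hβ hc.1 hc.2 hsize
    omega
  | succ j ih =>
    intro hj s' hs'
    have hc := hsmall _ (Nat.sub_le _ _) s' hs'
    have hc' := test_lt_cost_le hβ hc.1 hc.2 hsize
    obtain ⟨hb, t, s'', h1, h2, h3⟩ := hstep _ (by omega) s' hs'
    rw [show N - (j + 1) + 1 = N - j by omega] at h3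
    obtain ⟨t', s₃, h1', h2', h3'⟩ := ih (by omega) s'' h3
    refine ⟨_, s₃, .loop_step hb h1 h1', ?_, h3'⟩
    have : ((j + 1) * (k + 1) + 1) * stepTime β =
      stepTime β + k * stepTime β + (j * (k + 1) + 1) * stepTime β := by ring
    omega

/-- The integer variable that is stored in the array `a`. -/
abbrev IExp.var (a : ℕ) : IExp := .get a (.const 0)

end FieldRAM

namespace FieldRAM

variable {K : Type u}

/-! ## Computing the new weights -/

/-- The sum of the weights with index at least `k`, transformed by `φ`, with the convention that
the value is `1` at the start and `0` at the end. -/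
noncomputable def tailValue (φ : ℝ → ℝ) (w : ℕ → ℝ) (M k : ℕ) : ℝ :=
  if k = 0 then 1 else if M ≤ k then 0 else φ (∑ l ∈ Finset.Ico k M, w l)

/-- The clamp of `16 / 17` to an upper bound of `1`. -/
def clampProg : Prog :=
  .ite (.lt (.var 17) (.var 16))
    (.seq (.setInt 16 (.const 0) (.const 1)) (.setInt 17 (.const 0) (.const 1))) .skip

/-- The computation of one weight. The fraction `12 / 13` is the sum of the weights seen so far,
and the fraction `14 / 15` is the transformed sum of the previous step. -/
def rescaleStep : Prog :=
  .seq (.setInt 12 (.const 0) (.add (.mul (.var 12) (.get 8 (.var 11)))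
    (.mul (.get 7 (.var 11)) (.var 13)))) <|
  .seq (.setInt 13 (.const 0) (.mul (.var 13) (.get 8 (.var 11)))) <|
  .seq (.setInt 16 (.const 0) (.mul (.add (.mul (.var 12) (.get 0 (.const 2)))
    (.mul (.get 0 (.const 1)) (.var 13))) (.get 0 (.const 4)))) <|
  .seq (.setInt 17 (.const 0) (.mul (.var 13) (.add (.mul (.get 0 (.const 4)) (.get 0 (.const 2)))
    (.mul (.mul (.const 2) (.get 0 (.const 3))) (.get 0 (.const 1)))))) <|
  .seq clampProg <|
  .seq (.setInt 7 (.var 11) (.sub (.mul (.var 16) (.var 15)) (.mul (.var 14) (.var 17)))) <|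
  .seq (.setInt 8 (.var 11) (.mul (.var 17) (.var 15))) <|
  .seq (.setInt 14 (.const 0) (.var 16)) <|
  .seq (.setInt 15 (.const 0) (.var 17)) <|
  .setInt 11 (.const 0) (.sub (.var 11) (.const 1))

/-- The computation of the weights of the resolvent in the bank `1`. -/
def rescaleProg : Prog :=
  .seq (.setInt 11 (.const 0) (.sub (.get 5 (.const 0)) (.const 1))) <|
  .seq (.setInt 12 (.const 0) (.const 0)) <|
  .seq (.setInt 13 (.const 0) (.const 1)) <|
  .seq (.setInt 14 (.const 0) (.const 0)) <|
  .seq (.setInt 15 (.const 0) (.const 1)) <|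
  .seq (.loop (.lt (.const 0) (.var 11)) rescaleStep) <|
  .seq (.setInt 7 (.const 0) (.sub (.var 15) (.var 14))) <|
  .setInt 8 (.const 0) (.var 15)

/-- The memory holds the coefficients of the resolvent problem, and the weights `w` in the bank
`1`; the sizes of all these numbers are bounded by `γ`. -/
structure HoldsWeights (s : State K) (M γ : ℕ) (c lam : ℝ) (w : ℕ → ℝ) : Prop where
  pos : 0 < M
  count : s.int 5 0 = M
  count_le : M ≤ γ
  lam_pos : 0 < s.int 0 1
  lam_den : 0 < s.int 0 2
  lam_eq : lam = (s.int 0 1 : ℝ) / (s.int 0 2 : ℝ)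
  c_pos : 0 < s.int 0 3
  c_den : 0 < s.int 0 4
  c_eq : c = (s.int 0 3 : ℝ) / (s.int 0 4 : ℝ)
  bits_coeff : ∀ i, 1 ≤ i → i ≤ 4 → bits (s.int 0 i) ≤ γ
  num_nonneg : ∀ l < M, 0 ≤ s.int 7 l
  den : ∀ l < M, 0 < s.int 8 l
  weight : ∀ l < M, w l = (s.int 7 l : ℝ) / (s.int 8 l : ℝ)
  sum_le : ∑ l ∈ Finset.range M, w l ≤ 1
  bits_num : ∀ l < M, bits (s.int 7 l) ≤ γ
  sum_bits : 1 + ∑ l ∈ Finset.range M, bits (s.int 8 l) ≤ γ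

/-- The invariant of the loop of `rescaleProg`: the weights from the index `j` on are done. -/
structure RescaleInv (s : State K) (M γ : ℕ) (φ : ℝ → ℝ) (w : ℕ → ℝ) (j : ℕ) (s' : State K) :
    Prop where
  fld : s'.fld = s.fld
  int : ∀ a < 7, s'.int a = s.int a
  counter : s'.int 11 0 = (j : ℤ) - 1
  den_pos : 0 < s'.int 13 0
  bits_den : bits (s'.int 13 0) ≤ 1 + ∑ l ∈ Finset.Ico j M, bits (s.int 8 l)
  num : (s'.int 12 0 : ℝ) = (∑ l ∈ Finset.Ico j M, w l) * s'.int 13 0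
  prev_den : 0 < s'.int 15 0
  prev : (s'.int 14 0 : ℝ) = tailValue φ w M j * s'.int 15 0
  bits_prev : bits (s'.int 14 0) ≤ 20 * γ
  bits_prev_den : bits (s'.int 15 0) ≤ 20 * γ
  todo : ∀ l < j, s'.int 7 l = s.int 7 l ∧ s'.int 8 l = s.int 8 l
  done : ∀ l, j ≤ l → l < M → 0 < s'.int 8 l ∧
    (s'.int 7 l : ℝ) = (tailValue φ w M l - tailValue φ w M (l + 1)) * s'.int 8 l

/-- The one-variable resolvent in integer arithmetic. For nonnegative `t` the fraction is
nonnegative, so the lower clamp is idle and the program clamps only from above. -/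
theorem coordResolvent_div {c lam t N D ln ld cn cd : ℝ} (hD : 0 < D) (hld : 0 < ld) (hcd : 0 < cd)
    (hln : 0 < ln) (hcn : 0 < cn) (hN : N = t * D) (ht : 0 ≤ t) (hlam : lam = ln / ld)
    (hc : c = cn / cd) :
    coordResolvent c lam t =
      min 1 (((N * ld + ln * D) * cd) / (D * (cd * ld + 2 * cn * ln))) := by
  have h : (t + lam) / (1 + 2 * c * lam) =
      ((N * ld + ln * D) * cd) / (D * (cd * ld + 2 * cn * ln)) := by
    rw [hN, hlam, hc]
    field_simp
  rw [coordResolvent, h, max_eq_right]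
  rw [hN]
  positivity

variable {s : State K} {M γ β : ℕ} {c lam : ℝ} {w : ℕ → ℝ}

theorem HoldsWeights.weight_nonneg (h : HoldsWeights s M γ c lam w) {l : ℕ} (hl : l < M) :
    0 ≤ w l := by
  rw [h.weight l hl]
  have h1 := h.num_nonneg l hl
  have h2 := h.den l hl
  positivity

theorem HoldsWeights.sum_nonneg (h : HoldsWeights s M γ c lam w) (j : ℕ) :
    0 ≤ ∑ l ∈ Finset.Ico j M, w l :=
  Finset.sum_nonneg fun _ hl => h.weight_nonneg (Finset.mem_Ico.1 hl).2

theorem HoldsWeights.sum_Ico_le_one (h : HoldsWeights s M γ c lam w) (j : ℕ) :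
    ∑ l ∈ Finset.Ico j M, w l ≤ 1 :=
  (Finset.sum_le_sum_of_subset_of_nonneg
    (fun _ hl => Finset.mem_range.2 (Finset.mem_Ico.1 hl).2)
    fun _ hl _ => h.weight_nonneg (Finset.mem_range.1 hl)).trans h.sum_le

theorem HoldsWeights.bits_den_le (h : HoldsWeights s M γ c lam w) {l : ℕ} (hl : l < M) :
    bits (s.int 8 l) ≤ γ :=
  (Finset.single_le_sum (f := fun l => bits (s.int 8 l)) (fun _ _ => Nat.zero_le _)
    (Finset.mem_range.2 hl)).trans (le_trans (Nat.le_add_left _ _) h.sum_bits)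

theorem RescaleInv.bits_den_le {φ : ℝ → ℝ} {j : ℕ} {s' : State K}
    (h : HoldsWeights s M γ c lam w) (hI : RescaleInv s M γ φ w j s') :
    bits (s'.int 13 0) ≤ γ := by
  refine hI.bits_den.trans (le_trans (Nat.add_le_add_left ?_ 1) h.sum_bits)
  exact Finset.sum_le_sum_of_subset fun l hl => Finset.mem_range.2 (Finset.mem_Ico.1 hl).2

/-- A fraction in the unit interval has a numerator no longer than its denominator, so only the
running denominator needs a bit budget. -/
theorem bits_num_le {N D : ℤ} {t : ℝ} (hD : 0 < D) (hN : (N : ℝ) = t * D) (h0 : 0 ≤ t)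
    (h1 : t ≤ 1) : 0 ≤ N ∧ bits N ≤ bits D := by
  have hD' : (0 : ℝ) < D := by exact_mod_cast hD
  have hN0 : 0 ≤ N := by
    have : (0 : ℝ) ≤ N := hN ▸ mul_nonneg h0 hD'.le
    exact_mod_cast this
  refine ⟨hN0, bits_mono hN0 ?_⟩
  have : (N : ℝ) ≤ D := by
    rw [hN]
    nlinarith
  exact_mod_cast this

variable [Field K]

theorem runs_clampProg (hβ : 1 ≤ β) {s : State K} {Q : State K → Prop}
    (h16 : bits (s.int 16 0) ≤ β) (h17 : bits (s.int 17 0) ≤ β)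
    (h1 : s.int 17 0 < s.int 16 0 → Q ((s.writeInt 16 0 1).writeInt 17 0 1))
    (h2 : s.int 16 0 ≤ s.int 17 0 → Q s) : Runs β clampProg s 3 Q := by
  have hb1 : bits 1 ≤ β := bits_one ▸ hβ
  refine Runs.ite (k := 2) hβ (by simp [IExp.Small, IExp.eval, bits_zero, *])
    (by simp [IExp.Small, IExp.eval, bits_zero, *]) (by decide) (fun h => ?_) (fun h => ?_)
  · refine Runs.setInt_seq hβ (by simp [IExp.Small, bits_zero]) (by simpa [IExp.Small])
      (by decide) (Runs.setInt hβ (by simp [IExp.Small, bits_zero]) (by simpa [IExp.Small])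
      (by decide) ?_)
    simpa [IExp.eval] using h1 (by simpa [IExp.eval] using h)
  · exact (Runs.skip (h2 (by simpa [IExp.eval] using h))).mono one_le_two fun _ h => h

/-- The effect of `rescaleStep`: the new sum `N / D`, and the clamped fraction `A / B`. -/
structure StepPost (s : State K) (k : ℕ) (N D U V A B : ℤ) (s' : State K) : Prop where
  fld : s'.fld = s.fld
  int : ∀ a < 7, s'.int a = s.int a
  num : s'.int 12 0 = N
  den : s'.int 13 0 = D
  new_num : s'.int 14 0 = if B < A then 1 else A
  new_den : s'.int 15 0 = if B < A then 1 else B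
  counter : s'.int 11 0 = (k : ℤ) - 1
  weight_num : s'.int 7 = Function.update (s.int 7) k (s'.int 14 0 * V - U * s'.int 15 0)
  weight_den : s'.int 8 = Function.update (s.int 8) k (s'.int 15 0 * V)

/-- Symbolic execution only: memory entries and intermediate results are variables with assumed bit
bounds, and their meaning is supplied in `runs_rescaleStep`. The 12 steps are nine assignments and
three for the clamp. -/
theorem runs_rescaleStep_stepPost {s : State K} {k : ℕ}
    {N D U V a b ln ld cn cd N₁ D₁ A B : ℤ} (hβ : 3 ≤ β)
    (h11 : s.int 11 0 = k) (h12 : s.int 12 0 = N) (h13 : s.int 13 0 = D) (h14 : s.int 14 0 = U)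
    (h15 : s.int 15 0 = V) (h7 : s.int 7 k = a) (h8 : s.int 8 k = b) (h01 : s.int 0 1 = ln)
    (h02 : s.int 0 2 = ld) (h03 : s.int 0 3 = cn) (h04 : s.int 0 4 = cd)
    (hN₁ : N * b + a * D = N₁) (hD₁ : D * b = D₁) (hA : (N₁ * ld + ln * D₁) * cd = A)
    (hB : D₁ * (cd * ld + 2 * cn * ln) = B)
    (bk : bits (k : ℤ) ≤ β) (bN : bits N ≤ β) (bD : bits D ≤ β) (bU : bits U ≤ β)
    (bV : bits V ≤ β) (ba : bits a ≤ β) (bb : bits b ≤ β) (bln : bits ln ≤ β) (bld : bits ld ≤ β)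
    (bcn : bits cn ≤ β) (bcd : bits cd ≤ β) (bN₁ : bits N₁ ≤ β) (bD₁ : bits D₁ ≤ β)
    (bA : bits A ≤ β) (bB : bits B ≤ β) :
    Runs β rescaleStep s 12 (StepPost s k N₁ D₁ U V A B) := by
  have hβ1 : 1 ≤ β := by omega
  have b0 : bits 0 ≤ β := by simp [bits_zero]
  have b1 : bits 1 ≤ β := by rw [bits_one]; omega
  have b2 : bits 2 ≤ β := by rw [bits_two]; omega
  have b3 : bits 3 ≤ β := by rw [show bits 3 = 2 by decide]; omega
  have b4 : bits 4 ≤ β := by rw [show bits 4 = 3 by decide]; omega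
  unfold rescaleStep
  refine Runs.setInt_seq (k := 11) hβ1 (by simpa [IExp.Small] using b0)
    (by simp [IExp.Small, IExp.eval, *]) (by decide) ?_
  simp only [IExp.eval, Int.toNat_zero, Int.toNat_natCast, h11, h12, h13, h7, h8, hN₁]
  refine Runs.setInt_seq (k := 10) hβ1 (by simpa [IExp.Small] using b0)
    (by simp [IExp.Small, IExp.eval, int_writeInt_of_ne, *]) (by decide) ?_
  simp only [IExp.eval, Int.toNat_zero, Int.toNat_natCast, int_writeInt_of_ne, ne_eq,
    Nat.reduceEqDiff, not_false_eq_true, h11, h13, h8, hD₁]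
  refine Runs.setInt_seq (k := 9) hβ1 (by simpa [IExp.Small] using b0)
    (by simp [IExp.Small, IExp.eval, int_writeInt_of_ne, int_writeInt_same, *]) (by decide) ?_
  simp only [IExp.eval, Int.toNat_zero, int_writeInt_of_ne, int_writeInt_same,
    Function.update_self, ne_eq, Nat.reduceEqDiff, not_false_eq_true, Int.reduceToNat, Int.toNat_one,
    OfNat.zero_ne_ofNat, h01, h02, h04, hA]
  refine Runs.setInt_seq (k := 8) hβ1 (by simpa [IExp.Small] using b0)
    (by simp [IExp.Small, IExp.eval, int_writeInt_of_ne, int_writeInt_same, *]) (by decide) ?_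
  simp only [IExp.eval, Int.toNat_zero, int_writeInt_of_ne, int_writeInt_same,
    Function.update_self, ne_eq, Nat.reduceEqDiff, not_false_eq_true, Int.reduceToNat, Int.toNat_one,
    OfNat.zero_ne_ofNat, h01, h02, h03, h04, hB]
  obtain ⟨A', hA'⟩ : ∃ A', (if B < A then 1 else A) = A' := ⟨_, rfl⟩
  obtain ⟨B', hB'⟩ : ∃ B', (if B < A then 1 else B) = B' := ⟨_, rfl⟩
  have bA' : bits A' ≤ β := by rw [← hA']; split_ifs; exacts [b1, bA]
  have bB' : bits B' ≤ β := by rw [← hB']; split_ifs; exacts [b1, bB]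
  refine Runs.seq (k := 3) (k' := 5) (Q := fun s₁ => s₁.fld = s.fld ∧
    (∀ a, a ≠ 12 → a ≠ 13 → a ≠ 16 → a ≠ 17 → s₁.int a = s.int a) ∧ s₁.int 12 0 = N₁ ∧
    s₁.int 13 0 = D₁ ∧ s₁.int 16 0 = A' ∧ s₁.int 17 0 = B')
    (runs_clampProg hβ1 ?_ ?_ ?_ ?_) ?_
  · simpa [int_writeInt_of_ne, int_writeInt_same] using bA
  · simpa [int_writeInt_of_ne, int_writeInt_same] using bB
  · intro h
    simp only [int_writeInt_of_ne, int_writeInt_same, Function.update_self, ne_eq,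
      Nat.reduceEqDiff, not_false_eq_true] at h
    rw [if_pos h] at hA' hB'
    refine ⟨by simp [fld_writeInt], fun a h1 h2 h3 h4 => ?_, ?_⟩
    · simp [int_writeInt_of_ne, *]
    · simp [int_writeInt_of_ne, int_writeInt_same, ← hA', ← hB']
  · intro h
    simp only [int_writeInt_of_ne, int_writeInt_same, Function.update_self, ne_eq,
      Nat.reduceEqDiff, not_false_eq_true] at h
    rw [if_neg h.not_gt] at hA' hB'
    refine ⟨by simp [fld_writeInt], fun a h1 h2 h3 h4 => ?_, ?_⟩
    · simp [int_writeInt_of_ne, *]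
    · simp [int_writeInt_of_ne, int_writeInt_same, ← hA', ← hB']
  rintro s₁ ⟨hfld, hint, h12', h13', h16', h17'⟩
  have h11' : s₁.int 11 0 = k := by simpa [hint 11] using h11
  have h14' : s₁.int 14 0 = U := by simpa [hint 14] using h14
  have h15' : s₁.int 15 0 = V := by simpa [hint 15] using h15
  refine Runs.setInt_seq (k := 4) hβ1 (by simp [IExp.Small, IExp.eval, *])
    (by simp [IExp.Small, IExp.eval, *]) (by decide) ?_
  simp only [IExp.eval, Int.toNat_zero, Int.toNat_natCast, h11', h14', h15', h16', h17']
  refine Runs.setInt_seq (k := 3) hβ1 (by simp [IExp.Small, IExp.eval, int_writeInt_of_ne, *])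
    (by simp [IExp.Small, IExp.eval, int_writeInt_of_ne, *]) (by decide) ?_
  simp only [IExp.eval, Int.toNat_zero, Int.toNat_natCast, int_writeInt_of_ne, ne_eq,
    Nat.reduceEqDiff, not_false_eq_true, h11', h15', h17']
  refine Runs.setInt_seq (k := 2) hβ1 (by simpa [IExp.Small] using b0)
    (by simp [IExp.Small, IExp.eval, int_writeInt_of_ne, *]) (by decide) ?_
  simp only [IExp.eval, Int.toNat_zero, int_writeInt_of_ne, ne_eq,
    Nat.reduceEqDiff, not_false_eq_true, h16']
  refine Runs.setInt_seq (k := 1) hβ1 (by simpa [IExp.Small] using b0)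
    (by simp [IExp.Small, IExp.eval, int_writeInt_of_ne, *]) (by decide) ?_
  simp only [IExp.eval, Int.toNat_zero, int_writeInt_of_ne, ne_eq,
    Nat.reduceEqDiff, not_false_eq_true, h17']
  refine Runs.setInt hβ1 (by simpa [IExp.Small] using b0)
    (by simp [IExp.Small, IExp.eval, int_writeInt_of_ne, *]) (by decide) ?_
  simp only [IExp.eval, Int.toNat_zero, int_writeInt_of_ne, ne_eq,
    Nat.reduceEqDiff, not_false_eq_true, h11']
  have h7' : s₁.int 7 = s.int 7 := hint 7 (by norm_num) (by norm_num) (by norm_num) (by norm_num)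
  have h8' : s₁.int 8 = s.int 8 := hint 8 (by norm_num) (by norm_num) (by norm_num) (by norm_num)
  constructor
  · simp [fld_writeInt, hfld]
  · intro a h
    rw [← hint a (by omega) (by omega) (by omega) (by omega)]
    simp [int_writeInt_of_ne, show a ≠ 7 by omega, show a ≠ 8 by omega, show a ≠ 14 by omega,
      show a ≠ 15 by omega, show a ≠ 11 by omega]
  all_goals simp [int_writeInt_of_ne, int_writeInt_same, *]

/-- The running denominator is multiplied by one new denominator, which matches the additive bit
bound of the invariant. The fraction `A / B` uses only the new sum and the coefficients of the
problem. The finished weights need no bit bound, as they are not read again. -/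
theorem runs_rescaleStep (h : HoldsWeights s M γ c lam w)
    (hβ : 20 * γ ≤ β) (hγ : 2 ≤ γ) {k : ℕ} (hk : 0 < k) (hkM : k < M) {s' : State K}
    (hI : RescaleInv s M γ (coordResolvent c lam) w (k + 1) s') :
    Runs β rescaleStep s' 12 (RescaleInv s M γ (coordResolvent c lam) w k) := by
  have hβ1 : 1 ≤ β := by omega
  have hγβ : γ ≤ β := by omega
  have hb1 : bits 1 ≤ γ := by rw [bits_one]; omega
  have hb2 : bits 2 ≤ γ := by rw [bits_two]; omega
  have hb4 : bits 4 ≤ β := by rw [show bits 4 = 3 by decide]; omega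
  obtain ⟨N, hN⟩ : ∃ N, N = s'.int 12 0 := ⟨_, rfl⟩
  obtain ⟨D, hD⟩ : ∃ D, D = s'.int 13 0 := ⟨_, rfl⟩
  obtain ⟨U, hU⟩ : ∃ U, U = s'.int 14 0 := ⟨_, rfl⟩
  obtain ⟨V, hV⟩ : ∃ V, V = s'.int 15 0 := ⟨_, rfl⟩
  have hcount : s'.int 11 0 = k := by rw [hI.counter]; push_cast; ring
  have hbk : bits (k : ℤ) ≤ γ := bits_natCast_le_of_le (hkM.le.trans h.count_le)
  have h7 := (hI.todo k (Nat.lt_succ_self k)).1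
  have h8 := (hI.todo k (Nat.lt_succ_self k)).2
  obtain ⟨a, ha⟩ : ∃ a, a = s.int 7 k := ⟨_, rfl⟩
  obtain ⟨b, hb⟩ : ∃ b, b = s.int 8 k := ⟨_, rfl⟩
  have hint0 := hI.int 0 (by norm_num)
  have hDpos : 0 < D := hD ▸ hI.den_pos
  have hbD : bits D ≤ γ := hD ▸ hI.bits_den_le h
  have hbN : bits N ≤ γ := by
    rw [hN]
    exact (bits_num_le hI.den_pos hI.num (h.sum_nonneg _) (h.sum_Ico_le_one _)).2.trans
      (hI.bits_den_le h)
  have hapos : 0 ≤ a := ha ▸ h.num_nonneg k hkM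
  have hbpos : 0 < b := hb ▸ h.den k hkM
  have hba : bits a ≤ γ := ha ▸ h.bits_num k hkM
  have hbb : bits b ≤ γ := hb ▸ h.bits_den_le hkM
  obtain ⟨N₁, hN₁⟩ : ∃ N₁, N₁ = N * b + a * D := ⟨_, rfl⟩
  obtain ⟨D₁, hD₁⟩ : ∃ D₁, D₁ = D * b := ⟨_, rfl⟩
  have hD₁pos : 0 < D₁ := hD₁ ▸ mul_pos hDpos hbpos
  have hsplit : ∑ l ∈ Finset.Ico k M, w l = w k + ∑ l ∈ Finset.Ico (k + 1) M, w l :=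
    Finset.sum_eq_sum_Ico_succ_bot hkM w
  have hN₁eq : (N₁ : ℝ) = (∑ l ∈ Finset.Ico k M, w l) * D₁ := by
    have h1 : (N : ℝ) = (∑ l ∈ Finset.Ico (k + 1) M, w l) * D := by rw [hN, hD]; exact hI.num
    have h2 : w k = (a : ℝ) / b := by rw [ha, hb]; exact h.weight k hkM
    have hb0 : (b : ℝ) ≠ 0 := by exact_mod_cast hbpos.ne'
    rw [hN₁, hD₁, hsplit, h2]
    push_cast
    rw [h1]
    field_simp
    ring
  have hbD₁' : bits D₁ ≤ 1 + ∑ l ∈ Finset.Ico k M, bits (s.int 8 l) := by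
    have h1 : bits D ≤ 1 + ∑ l ∈ Finset.Ico (k + 1) M, bits (s.int 8 l) := hD ▸ hI.bits_den
    have h2 := bits_mul_le D b
    rw [Finset.sum_eq_sum_Ico_succ_bot hkM, ← hb, hD₁]
    omega
  have hbD₁ : bits D₁ ≤ γ := by
    refine hbD₁'.trans (le_trans (Nat.add_le_add_left ?_ 1) h.sum_bits)
    exact Finset.sum_le_sum_of_subset fun l hl => Finset.mem_range.2 (Finset.mem_Ico.1 hl).2
  have hN₁' := bits_num_le hD₁pos hN₁eq (h.sum_nonneg _) (h.sum_Ico_le_one _)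
  have hbN₁ : bits N₁ ≤ γ := hN₁'.2.trans hbD₁
  obtain ⟨ln, hln⟩ : ∃ z, z = s.int 0 1 := ⟨_, rfl⟩
  obtain ⟨ld, hld⟩ : ∃ z, z = s.int 0 2 := ⟨_, rfl⟩
  obtain ⟨cn, hcn⟩ : ∃ z, z = s.int 0 3 := ⟨_, rfl⟩
  obtain ⟨cd, hcd⟩ : ∃ z, z = s.int 0 4 := ⟨_, rfl⟩
  have hbln : bits ln ≤ γ := hln ▸ h.bits_coeff 1 (by norm_num) (by norm_num)
  have hbld : bits ld ≤ γ := hld ▸ h.bits_coeff 2 (by norm_num) (by norm_num)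
  have hbcn : bits cn ≤ γ := hcn ▸ h.bits_coeff 3 (by norm_num) (by norm_num)
  have hbcd : bits cd ≤ γ := hcd ▸ h.bits_coeff 4 (by norm_num) (by norm_num)
  have hlnpos : 0 < ln := hln ▸ h.lam_pos
  have hldpos : 0 < ld := hld ▸ h.lam_den
  have hcnpos : 0 < cn := hcn ▸ h.c_pos
  have hcdpos : 0 < cd := hcd ▸ h.c_den
  obtain ⟨A, hA⟩ : ∃ A, A = (N₁ * ld + ln * D₁) * cd := ⟨_, rfl⟩
  obtain ⟨B, hB⟩ : ∃ B, B = D₁ * (cd * ld + 2 * cn * ln) := ⟨_, rfl⟩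
  have hApos : 0 < A := by
    have := hN₁'.1
    rw [hA]
    positivity
  have hBpos : 0 < B := by
    rw [hB]
    positivity
  -- A product of two lengths `γ`, a carry and a further factor: about `3 * γ` bits, and likewise
  -- for `B`. The factor 20 is generous.
  have hbA : bits A ≤ 20 * γ := by
    have h1 := bits_mul_le (N₁ * ld + ln * D₁) cd
    have h2 := bits_add_le (N₁ * ld) (ln * D₁)
    have h3 := bits_mul_le N₁ ld
    have h4 := bits_mul_le ln D₁
    rw [hA]
    omega
  have hbB : bits B ≤ 20 * γ := by
    have h1 := bits_mul_le D₁ (cd * ld + 2 * cn * ln)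
    have h2 := bits_add_le (cd * ld) (2 * cn * ln)
    have h3 := bits_mul_le cd ld
    have h4 := bits_mul_le (2 * cn) ln
    have h5 := bits_mul_le 2 cn
    rw [hB]
    omega
  have htail : tailValue (coordResolvent c lam) w M k = min 1 ((A : ℝ) / B) := by
    rw [tailValue, if_neg hk.ne', if_neg hkM.not_ge]
    refine (coordResolvent_div (N := N₁) (D := D₁) (ln := ln) (ld := ld) (cn := cn) (cd := cd)
      (by exact_mod_cast hD₁pos) (by exact_mod_cast hldpos) (by exact_mod_cast hcdpos)
      (by exact_mod_cast hlnpos) (by exact_mod_cast hcnpos) hN₁eq (h.sum_nonneg _)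
      (by rw [hln, hld]; exact h.lam_eq) (by rw [hcn, hcd]; exact h.c_eq)).trans ?_
    rw [hA, hB]
    push_cast
    rfl
  have hBpos' : (0 : ℝ) < B := by exact_mod_cast hBpos
  refine (runs_rescaleStep_stepPost (β := β) (U := U) (V := V) (by omega) hcount hN.symm hD.symm
    hU.symm hV.symm (h7.trans ha.symm) (h8.trans hb.symm) (hint0 ▸ hln.symm) (hint0 ▸ hld.symm)
    (hint0 ▸ hcn.symm) (hint0 ▸ hcd.symm) hN₁.symm hD₁.symm hA.symm hB.symm (hbk.trans hγβ)
    (hbN.trans hγβ) (hbD.trans hγβ) (hU ▸ hI.bits_prev.trans hβ)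
    (hV ▸ hI.bits_prev_den.trans hβ) (hba.trans hγβ) (hbb.trans hγβ) (hbln.trans hγβ)
    (hbld.trans hγβ) (hbcn.trans hγβ) (hbcd.trans hγβ) (hbN₁.trans hγβ) (hbD₁.trans hγβ)
    (hbA.trans hβ) (hbB.trans hβ)).mono le_rfl fun s₁ h₁ => ?_
  have hden : 0 < s₁.int 15 0 := by
    rw [h₁.new_den]
    split_ifs
    exacts [one_pos, hBpos]
  have hnum : (s₁.int 14 0 : ℝ) = tailValue (coordResolvent c lam) w M k * s₁.int 15 0 := by
    rw [h₁.new_den, h₁.new_num, htail]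
    split_ifs with hlt
    · have hlt' : (B : ℝ) < A := by exact_mod_cast hlt
      rw [min_eq_left ((one_le_div hBpos').2 hlt'.le), one_mul]
    · have hle : (A : ℝ) ≤ B := by exact_mod_cast not_lt.1 hlt
      rw [min_eq_right ((div_le_one hBpos').2 hle), div_mul_cancel₀ _ hBpos'.ne']
  refine ⟨h₁.fld.trans hI.fld, fun i hi => (h₁.int i hi).trans (hI.int i hi), h₁.counter,
    h₁.den ▸ hD₁pos, h₁.den ▸ hbD₁', ?_, hden, hnum, ?_, ?_, fun l hl => ?_, fun l hl hlM => ?_⟩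
  · rw [h₁.num, h₁.den, hN₁eq]
  · rw [h₁.new_num]
    split_ifs
    · rw [bits_one]; omega
    · exact hbA
  · rw [h₁.new_den]
    split_ifs
    · rw [bits_one]; omega
    · exact hbB
  · rw [h₁.weight_num, h₁.weight_den, Function.update_of_ne hl.ne, Function.update_of_ne hl.ne]
    exact hI.todo l (by omega)
  · rw [h₁.weight_num, h₁.weight_den]
    rcases hl.eq_or_lt with rfl | hlt
    · rw [Function.update_self, Function.update_self]
      refine ⟨mul_pos hden (hV ▸ hI.prev_den), ?_⟩
      have hprev : (U : ℝ) = tailValue (coordResolvent c lam) w M (k + 1) * V := by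
        rw [hU, hV]
        exact hI.prev
      push_cast
      rw [hnum, hprev]
      ring
    · rw [Function.update_of_ne hlt.ne', Function.update_of_ne hlt.ne']
      exact hI.done l hlt hlM


theorem runs_rescaleProg (h : HoldsWeights s M γ c lam w) (hβ : 20 * γ ≤ β) (hγ : 2 ≤ γ) :
    Runs β rescaleProg s (13 * M + 8) fun s' => s'.fld = s.fld ∧ (∀ a < 7, s'.int a = s.int a) ∧
      ∀ l < M, 0 < s'.int 8 l ∧ (s'.int 7 l : ℝ) / s'.int 8 l =
        tailValue (coordResolvent c lam) w M l - tailValue (coordResolvent c lam) w M (l + 1) := by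
  have hβ1 : 1 ≤ β := by omega
  have b0 : bits 0 ≤ β := by simp [bits_zero]
  have b1 : bits 1 ≤ β := by rw [bits_one]; omega
  have bM : bits (M : ℤ) ≤ β := bits_natCast_le_of_le (by have := h.count_le; omega)
  have hM := h.pos
  have hcount := h.count
  unfold rescaleProg
  refine Runs.mono (k := 1 + (1 + (1 + (1 + (1 + (((M - 1) * (12 + 1) + 1) + (1 + 1))))))) ?_
    (by omega) fun _ h => h
  refine Runs.setInt_seq hβ1 (by simpa [IExp.Small] using b0)
    (by simp [IExp.Small, IExp.eval, *]) (by decide) ?_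
  refine Runs.setInt_seq hβ1 (by simpa [IExp.Small] using b0)
    (by simpa [IExp.Small] using b0) (by decide) ?_
  refine Runs.setInt_seq hβ1 (by simpa [IExp.Small] using b0)
    (by simpa [IExp.Small] using b1) (by decide) ?_
  refine Runs.setInt_seq hβ1 (by simpa [IExp.Small] using b0)
    (by simpa [IExp.Small] using b0) (by decide) ?_
  refine Runs.setInt_seq hβ1 (by simpa [IExp.Small] using b0)
    (by simpa [IExp.Small] using b1) (by decide) ?_
  simp only [IExp.eval, Int.toNat_zero, hcount]
  -- The loop treats the indices from `M - 1` down to 1. Index 0 is left out because its tail value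
  -- is 1 by convention and not a value of the resolvent.
  refine Runs.seq (Runs.loop hβ1 (M - 1)
    (fun i => RescaleInv s M γ (coordResolvent c lam) w (M - i)) ?_ ?_ (by decide) ?_ ?_) ?_
  · constructor
    · simp [fld_writeInt]
    · intro a ha
      simp [int_writeInt_of_ne, show a ≠ 11 by omega, show a ≠ 12 by omega, show a ≠ 13 by omega,
        show a ≠ 14 by omega, show a ≠ 15 by omega]
    · simp [int_writeInt_of_ne, int_writeInt_same]
    · simp [int_writeInt_of_ne, int_writeInt_same]
    · simp [int_writeInt_of_ne, int_writeInt_same, bits_one]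
    · simp [int_writeInt_of_ne, int_writeInt_same]
    · simp [int_writeInt_same]
    · simp [int_writeInt_of_ne, int_writeInt_same, tailValue, hM.ne']
    · simp [int_writeInt_of_ne, int_writeInt_same, bits_zero]
    · simp [int_writeInt_same, bits_one]
      omega
    · intro l _
      simp [int_writeInt_of_ne]
    · intro l h1 h2
      omega
  · intro i hi s' hI
    have h1 : s'.int 11 0 = ((M - i - 1 : ℕ) : ℤ) := by rw [hI.counter]; omega
    have h2 : bits ((M - i - 1 : ℕ) : ℤ) ≤ β :=
      bits_natCast_le_of_le (by have := h.count_le; omega)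
    exact ⟨b0, by simp [IExp.Small, IExp.eval, h1, h2, b0]⟩
  · intro i hi s' hI
    refine ⟨by simp only [IExp.eval, Int.toNat_zero, hI.counter]; omega, ?_⟩
    rw [show M - (i + 1) = M - i - 1 by omega]
    refine runs_rescaleStep h hβ hγ (by omega) (by omega) ?_
    rwa [show M - i - 1 + 1 = M - i by omega]
  · intro s' hI
    simp only [IExp.eval, Int.toNat_zero, hI.counter]
    omega
  · intro s' hI
    rw [show M - (M - 1) = 1 by omega] at hI
    have b14 : bits (s'.int 14 0) ≤ β := hI.bits_prev.trans hβ
    have b15 : bits (s'.int 15 0) ≤ β := hI.bits_prev_den.trans hβ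
    refine Runs.setInt_seq hβ1 (by simpa [IExp.Small] using b0)
      (by simp [IExp.Small, IExp.eval, *]) (by decide) ?_
    refine Runs.setInt hβ1 (by simpa [IExp.Small] using b0)
      (by simp [IExp.Small, IExp.eval, int_writeInt_of_ne, *]) (by decide) ?_
    simp only [IExp.eval, Int.toNat_zero]
    refine ⟨hI.fld, fun a ha => ?_, fun l hl => ?_⟩
    · rw [← hI.int a ha]
      simp [int_writeInt_of_ne, show a ≠ 7 by omega, show a ≠ 8 by omega]
    · have hprev := hI.prev
      have hpd := hI.prev_den
      have hpd' : (0 : ℝ) < s'.int 15 0 := by exact_mod_cast hpd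
      rcases Nat.eq_zero_or_pos l with rfl | hl0
      · simp only [int_writeInt_of_ne, int_writeInt_same, Function.update_self, ne_eq,
          Nat.reduceEqDiff, not_false_eq_true]
        refine ⟨hpd, ?_⟩
        push_cast
        -- The weight of the minimum is whatever is missing to the total mass 1. For `M = 1` the
        -- loop is empty, the previous value is 0, and this weight is 1.
        have h0 : tailValue (coordResolvent c lam) w M 0 = 1 := if_pos rfl
        rw [hprev, div_eq_iff hpd'.ne', h0]
        ring
      · simp only [int_writeInt_of_ne, int_writeInt_same, ne_eq,
          Nat.reduceEqDiff, not_false_eq_true, Function.update_of_ne hl0.ne']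
        obtain ⟨h1, h2⟩ := hI.done l hl0 hl
        have h1' : (0 : ℝ) < s'.int 8 l := by exact_mod_cast h1
        exact ⟨h1, (div_eq_iff h1'.ne').2 h2⟩

end FieldRAM

namespace FieldRAM

variable {K : Type u}

/-! ## Insertion of the minimum and the maximum into the chain -/

/-- The dimension of the ambient space. -/
abbrev IExp.dim : IExp := .get 0 (.const 0)

/-- The integer part of the insertion: the variables `9` and `10` tell whether the minimum and
the maximum are missing. -/
def headProg : Prog :=
  .seq (.ite (.lt (.const 0) (.get 2 (.const 0)))
    (.setInt 9 (.const 0) (.const 1)) (.setInt 9 (.const 0) (.const 0))) <|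
  .seq (.ite (.lt (.get 2 (.sub (.get 1 (.const 0)) (.const 1))) .dim)
    (.setInt 10 (.const 0) (.const 1)) (.setInt 10 (.const 0) (.const 0))) <|
  .seq (.setInt 6 (.const 0) (.const 0)) <|
  .seq (.setInt 7 (.const 0) (.const 0)) <|
  .seq (.setInt 8 (.const 0) (.const 1)) <|
  .setInt 11 (.const 0) (.const 0)

/-- The loop that copies the dimensions and the coefficients of the chain. -/
def copyIntProg : Prog :=
  .loop (.lt (.var 11) (.get 1 (.const 0))) <|
  .seq (.setInt 6 (.add (.var 11) (.var 9)) (.get 2 (.var 11))) <|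
  .seq (.setInt 7 (.add (.var 11) (.var 9)) (.get 3 (.var 11))) <|
  .seq (.setInt 8 (.add (.var 11) (.var 9)) (.get 4 (.var 11))) <|
  .setInt 11 (.const 0) (.add (.var 11) (.const 1))

/-- The entries of the maximum, and the length of the new chain. -/
def lastProg : Prog :=
  .seq (.setInt 6 (.add (.get 1 (.const 0)) (.var 9)) .dim) <|
  .seq (.setInt 7 (.add (.get 1 (.const 0)) (.var 9)) (.const 0)) <|
  .seq (.setInt 8 (.add (.get 1 (.const 0)) (.var 9)) (.const 1)) <|
  .setInt 5 (.const 0) (.add (.add (.get 1 (.const 0)) (.var 9)) (.var 10))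

/-- The integer arrays after `headProg`. -/
structure HeadPost (s : State K) (m o t : ℕ) (s' : State K) : Prop where
  fld : s'.fld = s.fld
  int : ∀ a < 5, s'.int a = s.int a
  bot_missing : s'.int 9 0 = o
  top_missing : s'.int 10 0 = t
  bot : 0 < o → s'.int 6 0 = 0 ∧ s'.int 7 0 = 0 ∧ s'.int 8 0 = 1
  counter : s'.int 11 0 = m
  copied : ∀ k < m, s'.int 6 (k + o) = s.int 2 k ∧ s'.int 7 (k + o) = s.int 3 k ∧
    s'.int 8 (k + o) = s.int 4 k

/-- The integer arrays after the insertion. -/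
structure ChainPost (s : State K) (n m o t : ℕ) (int : ℕ → ℕ → ℤ) : Prop where
  int_eq : ∀ a < 5, int a = s.int a
  bot_missing : int 9 0 = o
  count : int 5 0 = m + o + t
  bot : 0 < o → int 6 0 = 0 ∧ int 7 0 = 0 ∧ int 8 0 = 1
  copied : ∀ k < m, int 6 (k + o) = s.int 2 k ∧ int 7 (k + o) = s.int 3 k ∧
    int 8 (k + o) = s.int 4 k
  top : int 6 (m + o) = n ∧ int 7 (m + o) = 0 ∧ int 8 (m + o) = 1

/-- Array 11 is the loop counter, the only integer array that changes while field entries are being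
written. -/
theorem ChainPost.congr {s : State K} {n m o t : ℕ} {i i' : ℕ → ℕ → ℤ}
    (h : ChainPost s n m o t i) (h' : ∀ a, a ≠ 11 → i' a = i a) : ChainPost s n m o t i' := by
  have h5 := h' 5 (by norm_num)
  have h6 := h' 6 (by norm_num)
  have h7 := h' 7 (by norm_num)
  have h8 := h' 8 (by norm_num)
  have h9 := h' 9 (by norm_num)
  exact ⟨fun a ha => (h' a (by omega)).trans (h.int_eq a ha), h9 ▸ h.bot_missing, h5 ▸ h.count,
    by rw [h6, h7, h8]; exact h.bot, by rw [h6, h7, h8]; exact h.copied,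
    by rw [h6, h7, h8]; exact h.top⟩

variable [Field K] {s : State K} {n m o t β : ℕ}

/-- The entries of the minimum are written to slot 0 in any case. If the minimum is already present,
then `o = 0` and the first copied entry overwrites them, so they are asserted only for `0 < o`. -/
theorem runs_headProg (hβ : 3 ≤ β) (hm : s.int 1 0 = m) (hm0 : 0 < m) (hn : s.int 0 0 = n)
    (ho : o = if 0 < s.int 2 0 then 1 else 0) (ht : t = if s.int 2 (m - 1) < n then 1 else 0)
    (bm : bits (m : ℤ) ≤ β) (bn : bits (n : ℤ) ≤ β) (b2 : ∀ k < m, bits (s.int 2 k) ≤ β) :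
    Runs β headProg s 8 (HeadPost s 0 o t) := by
  have hβ1 : 1 ≤ β := by omega
  have b0 : bits 0 ≤ β := by simp [bits_zero]
  have b1 : bits 1 ≤ β := by rw [bits_one]; omega
  have b20 := b2 0 hm0
  have b2m := b2 (m - 1) (by omega)
  have e : ((m : ℤ) - 1).toNat = m - 1 := by omega
  have ite_const : ∀ {a : ℕ} {s : State K} {e f : IExp}, e.Small s β → f.Small s β →
      e.size + f.size ≤ 40 → Runs β (.ite (.lt e f) (.setInt a (.const 0) (.const 1))
        (.setInt a (.const 0) (.const 0))) s 2
        fun s' => s' = s.writeInt a 0 (if e.eval s < f.eval s then 1 else 0) := by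
    intro a s e f he hf hs
    refine Runs.ite (k := 1) hβ1 he hf hs (fun h => ?_) (fun h => ?_)
    · exact Runs.setInt hβ1 (by simpa [IExp.Small] using b0) (by simpa [IExp.Small] using b1)
        (by simp [IExp.size]) (by simp [IExp.eval, h])
    · exact Runs.setInt hβ1 (by simpa [IExp.Small] using b0) (by simpa [IExp.Small] using b0)
        (by simp [IExp.size]) (by simp only [IExp.eval, Int.toNat_zero, if_neg h])
  refine Runs.seq (k := 2) (k' := 6) (ite_const (by simpa [IExp.Small] using b0)
    (by simp [IExp.Small, IExp.eval, *]) (by decide)) ?_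
  rintro _ rfl
  refine Runs.seq (k := 2) (k' := 4) (ite_const
    (by simp [IExp.Small, IExp.eval, int_writeInt_of_ne, *])
    (by simp [IExp.Small, IExp.eval, int_writeInt_of_ne, *]) (by decide)) ?_
  rintro _ rfl
  refine Runs.setInt_seq (k := 3) hβ1 (by simpa [IExp.Small] using b0)
    (by simpa [IExp.Small] using b0) (by decide) ?_
  refine Runs.setInt_seq (k := 2) hβ1 (by simpa [IExp.Small] using b0)
    (by simpa [IExp.Small] using b0) (by decide) ?_
  refine Runs.setInt_seq (k := 1) hβ1 (by simpa [IExp.Small] using b0)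
    (by simpa [IExp.Small] using b1) (by decide) ?_
  refine Runs.setInt hβ1 (by simpa [IExp.Small] using b0)
    (by simpa [IExp.Small] using b0) (by decide) ?_
  constructor
  · simp [fld_writeInt]
  · intro a ha
    simp [int_writeInt_of_ne, show a ≠ 6 by omega, show a ≠ 7 by omega, show a ≠ 8 by omega,
      show a ≠ 9 by omega, show a ≠ 10 by omega, show a ≠ 11 by omega]
  · simp [int_writeInt_of_ne, int_writeInt_same, IExp.eval, ho]
    congr
  · simp [int_writeInt_of_ne, int_writeInt_same, IExp.eval, ht, hm, hn, e]
  · intro _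
    simp [int_writeInt_of_ne, int_writeInt_same, IExp.eval]
  · simp [int_writeInt_same, IExp.eval]
  · intro k hk
    omega

theorem runs_copyIntProg (hβ : 3 ≤ β) (hm : s.int 1 0 = m) (ho : o ≤ 1)
    (bm : m ≤ β) (b2 : ∀ k < m, bits (s.int 2 k) ≤ β)
    (b3 : ∀ k < m, bits (s.int 3 k) ≤ β) (b4 : ∀ k < m, bits (s.int 4 k) ≤ β) {s₁ : State K}
    (h : HeadPost s 0 o t s₁) :
    Runs β copyIntProg s₁ (m * 5 + 1) (HeadPost s m o t) := by
  have hβ1 : 1 ≤ β := by omega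
  have b0 : bits 0 ≤ β := by simp [bits_zero]
  have b1 : bits 1 ≤ β := by rw [bits_one]; omega
  have bo : bits (o : ℤ) ≤ β := bits_natCast_le_of_le (by omega)
  have bm' : bits (m : ℤ) ≤ β := bits_natCast_le_of_le bm
  refine Runs.loop hβ1 m (fun i => HeadPost s i o t) h ?_ (by decide) ?_ ?_
  · intro i hi s' h'
    have bi : bits (i : ℤ) ≤ β := bits_natCast_le_of_le (hi.trans bm)
    have h1 := h'.int 1 (by norm_num)
    have h2 := h'.counter
    simp [IExp.Small, IExp.eval, *]
  · intro i hi s' h'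
    have bi : bits (i : ℤ) ≤ β := bits_natCast_le_of_le (hi.le.trans bm)
    have h1 := h'.int 1 (by norm_num)
    have h2 := h'.int 2 (by norm_num)
    have h3 := h'.int 3 (by norm_num)
    have h4 := h'.int 4 (by norm_num)
    have h11 := h'.counter
    have h9 := h'.bot_missing
    have b2i := b2 i hi
    have b3i := b3 i hi
    have b4i := b4 i hi
    have e : ((i : ℤ) + (o : ℤ)).toNat = i + o := by omega
    refine ⟨by simp [IExp.eval, *], ?_⟩
    refine Runs.setInt_seq (k := 3) hβ1 (by simp [IExp.Small, IExp.eval, *])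
      (by simp [IExp.Small, IExp.eval, *]) (by decide) ?_
    simp only [IExp.eval, Int.toNat_zero, Int.toNat_natCast, h11, h9, h2, e]
    refine Runs.setInt_seq (k := 2) hβ1 (by simp [IExp.Small, IExp.eval, int_writeInt_of_ne, *])
      (by simp [IExp.Small, IExp.eval, int_writeInt_of_ne, *]) (by decide) ?_
    simp only [IExp.eval, Int.toNat_zero, Int.toNat_natCast, int_writeInt_of_ne, ne_eq,
      Nat.reduceEqDiff, not_false_eq_true, h11, h9, h3, e]
    refine Runs.setInt_seq (k := 1) hβ1 (by simp [IExp.Small, IExp.eval, int_writeInt_of_ne, *])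
      (by simp [IExp.Small, IExp.eval, int_writeInt_of_ne, *]) (by decide) ?_
    simp only [IExp.eval, Int.toNat_zero, Int.toNat_natCast, int_writeInt_of_ne, ne_eq,
      Nat.reduceEqDiff, not_false_eq_true, h11, h9, h4, e]
    refine Runs.setInt hβ1 (by simp [IExp.Small, IExp.eval, int_writeInt_of_ne, *])
      (by simp [IExp.Small, IExp.eval, int_writeInt_of_ne, *]) (by decide) ?_
    simp only [IExp.eval, Int.toNat_zero, int_writeInt_of_ne, ne_eq,
      Nat.reduceEqDiff, not_false_eq_true, h11]
    constructor
    · simp [fld_writeInt, h'.fld]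
    · intro a ha
      rw [← h'.int a ha]
      simp [int_writeInt_of_ne, show a ≠ 6 by omega, show a ≠ 7 by omega, show a ≠ 8 by omega,
        show a ≠ 11 by omega]
    · simp [int_writeInt_of_ne, h9]
    · simp [int_writeInt_of_ne, h'.top_missing]
    · intro ho'
      simp [int_writeInt_of_ne, int_writeInt_same, Function.update_of_ne (show 0 ≠ i + o by omega),
        h'.bot ho']
    · simp [int_writeInt_same]
    · intro k hk
      rcases (Nat.lt_succ_iff.1 hk).eq_or_lt with rfl | hlt
      · simp [int_writeInt_of_ne, int_writeInt_same]
      · simp [int_writeInt_of_ne, int_writeInt_same, hlt.ne, h'.copied k hlt]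
  · intro s' h'
    simp [IExp.eval, h'.counter, h'.int 1, hm]

/-- The entries of the maximum are also written in any case; for `t = 0` they lie just beyond the
recorded length and are ignored. -/
theorem runs_lastProg (hβ : 3 ≤ β) (hm : s.int 1 0 = m) (hn : s.int 0 0 = n) (ho : o ≤ 1)
    (ht : t ≤ 1) (bm : m ≤ β) (bn : n ≤ β) {s₁ : State K} (h : HeadPost s m o t s₁) (hm0 : 0 < m) :
    Runs β lastProg s₁ 4 fun s' => s'.fld = s.fld ∧ ChainPost s n m o t s'.int := by
  have hβ1 : 1 ≤ β := by omega
  have b0 : bits 0 ≤ β := by simp [bits_zero]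
  have b1 : bits 1 ≤ β := by rw [bits_one]; omega
  have bo : bits (o : ℤ) ≤ β := bits_natCast_le_of_le (by omega)
  have bt : bits (t : ℤ) ≤ β := bits_natCast_le_of_le (by omega)
  have bm' : bits (m : ℤ) ≤ β := bits_natCast_le_of_le bm
  have bn' : bits (n : ℤ) ≤ β := bits_natCast_le_of_le bn
  have h0 := h.int 0 (by norm_num)
  have h1 := h.int 1 (by norm_num)
  have h9 := h.bot_missing
  have h10 := h.top_missing
  have e : ((m : ℤ) + (o : ℤ)).toNat = m + o := by omega
  refine Runs.setInt_seq (k := 3) hβ1 (by simp [IExp.Small, IExp.eval, *])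
    (by simp [IExp.Small, IExp.eval, *]) (by decide) ?_
  simp only [IExp.eval, Int.toNat_zero, h9, h0, h1, hm, hn, e]
  refine Runs.setInt_seq (k := 2) hβ1 (by simp [IExp.Small, IExp.eval, int_writeInt_of_ne, *])
    (by simpa [IExp.Small] using b0) (by decide) ?_
  simp only [IExp.eval, Int.toNat_zero, int_writeInt_of_ne, ne_eq, Nat.reduceEqDiff,
    not_false_eq_true, OfNat.one_ne_ofNat, h9, h1, hm, e]
  refine Runs.setInt_seq (k := 1) hβ1 (by simp [IExp.Small, IExp.eval, int_writeInt_of_ne, *])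
    (by simpa [IExp.Small] using b1) (by decide) ?_
  simp only [IExp.eval, Int.toNat_zero, int_writeInt_of_ne, ne_eq, Nat.reduceEqDiff,
    not_false_eq_true, OfNat.one_ne_ofNat, h9, h1, hm, e]
  refine Runs.setInt hβ1 (by simpa [IExp.Small] using b0)
    (by simp [IExp.Small, IExp.eval, int_writeInt_of_ne, *]) (by decide) ?_
  simp only [IExp.eval, Int.toNat_zero, int_writeInt_of_ne, ne_eq, Nat.reduceEqDiff,
    not_false_eq_true, OfNat.one_ne_ofNat, h9, h10, h1, hm]
  refine ⟨by simp [fld_writeInt, h.fld], ?_⟩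
  constructor
  · intro a ha
    rw [← h.int a ha]
    simp [int_writeInt_of_ne, show a ≠ 6 by omega, show a ≠ 7 by omega, show a ≠ 8 by omega,
      show a ≠ 5 by omega]
  · simp [int_writeInt_of_ne, h9]
  · simp [int_writeInt_same]
  · intro ho'
    simp [int_writeInt_of_ne, int_writeInt_same, Function.update_of_ne (show 0 ≠ m + o by omega),
      h.bot ho']
  · intro k hk
    simp [int_writeInt_of_ne, int_writeInt_same, hk.ne, h.copied k hk]
  · simp [int_writeInt_of_ne, int_writeInt_same]

/-- A loop over `11` that writes a field element in every round. -/
def fillProg (N i : IExp) (e : FExp) : Prog :=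
  .seq (.setInt 11 (.const 0) (.const 0)) <|
  .loop (.lt (.var 11) N) <|
  .seq (.setFld 1 i e) (.setInt 11 (.const 0) (.add (.var 11) (.const 1)))

theorem runs_fillProg (hβ : 3 ≤ β) {N i : IExp} {e : FExp} {L : ℕ} (hL : L ≤ β)
    (hsN : N.size ≤ 10) (hsi : i.size ≤ 20) (I : ℕ → (ℕ → K) → Prop) (h0 : I 0 (s.fld 1))
    (hN : ∀ s' : State K, (∀ a, a ≠ 11 → s'.int a = s.int a) → N.Small s' β ∧ N.eval s' = L)
    (hstep : ∀ k < L, ∀ s' : State K, (∀ a, a ≠ 11 → s'.int a = s.int a) →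
      s'.fld 0 = s.fld 0 → s'.int 11 0 = k → bits (k : ℤ) ≤ β → I k (s'.fld 1) →
      i.Small s' β ∧ e.cost s' ≤ 20 * (1 + 20 * β) ∧
        I (k + 1) (Function.update (s'.fld 1) (i.eval s').toNat (e.eval s'))) :
    Runs β (fillProg N i e) s (L * 3 + 2) fun s' =>
      (∀ a, a ≠ 11 → s'.int a = s.int a) ∧ s'.fld 0 = s.fld 0 ∧ I L (s'.fld 1) := by
  have hβ1 : 1 ≤ β := by omega
  have b0 : bits 0 ≤ β := by simp [bits_zero]
  have b1 : bits 1 ≤ β := by rw [bits_one]; omega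
  refine Runs.mono (k := 1 + (L * (2 + 1) + 1)) (Runs.setInt_seq hβ1 (by simpa [IExp.Small] using b0)
    (by simpa [IExp.Small] using b0) (by decide) (Runs.loop hβ1 L
    (fun k s' => ((∀ a, a ≠ 11 → s'.int a = s.int a) ∧ s'.fld 0 = s.fld 0 ∧ I k (s'.fld 1)) ∧
      s'.int 11 0 = k) ?_ ?_ (by simp only [IExp.size]; omega) ?_ ?_)) (by omega) fun _ h => h.1
  · refine ⟨⟨fun a ha => ?_, rfl, h0⟩, ?_⟩
    · simp [int_writeInt_of_ne, ha]
    · simp [int_writeInt_same, IExp.eval]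
  · rintro k hk s' ⟨⟨h1, -, -⟩, h2⟩
    have bk : bits (k : ℤ) ≤ β := bits_natCast_le_of_le (hk.trans hL)
    exact ⟨by simp [IExp.Small, IExp.eval, *], (hN s' h1).1⟩
  · rintro k hk s' ⟨⟨h1, h2, h3⟩, h4⟩
    have bk : bits (k : ℤ) ≤ β := bits_natCast_le_of_le (hk.le.trans hL)
    refine ⟨?_, ?_⟩
    · rw [(hN s' h1).2]
      simp only [IExp.eval, Int.toNat_zero, h4]
      omega
    · obtain ⟨h5, h6, h7⟩ := hstep k hk s' h1 h2 h4 bk h3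
      refine Runs.seq (k := 1) (k' := 1) (Q := fun s₁ => s₁.int = s'.int ∧ s₁.fld 0 = s'.fld 0 ∧
        I (k + 1) (s₁.fld 1)) (Runs.setFld hβ1 h5 h6 hsi ⟨rfl, ?_, ?_⟩) ?_
      · simp [fld_writeFld_of_ne]
      · rwa [fld_writeFld_same]
      · rintro s₁ ⟨h8, h9, h10⟩
        refine Runs.setInt hβ1 (by simpa [IExp.Small] using b0)
          (by simp [IExp.Small, IExp.eval, *]) (by decide) ⟨⟨fun a ha => ?_, ?_, ?_⟩, ?_⟩
        · rw [int_writeInt_of_ne _ ha, h8, h1 a ha]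
        · rw [fld_writeInt, h9, h2]
        · rwa [fld_writeInt]
        · simp [int_writeInt_same, IExp.eval, h8, h4]
  · rintro s' ⟨⟨h1, -, -⟩, h2⟩
    rw [(hN s' h1).2]
    simp [IExp.eval, h2]

/-- The number of entries that a subspace occupies. -/
abbrev IExp.block : IExp := .mul .dim .dim

/-- The insertion of the minimum and the maximum into the chain of the bank `0`; the result is in
the bank `1`. -/
def insertProg : Prog :=
  .seq headProg <| .seq copyIntProg <| .seq lastProg <|
  .seq (fillProg (.mul (.get 1 (.const 0)) .block) (.add (.var 11) (.mul (.var 9) .block))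
    (.get 0 (.var 11))) <|
  .seq (fillProg .block
    (.add (.var 11) (.mul (.add (.get 1 (.const 0)) (.var 9)) .block)) .zero) <|
  fillProg .dim (.add (.mul (.var 11) (.add .dim (.const 1)))
    (.mul (.add (.get 1 (.const 0)) (.var 9)) .block)) .one

/-- The copied vectors move by `o` blocks of `n * n` entries. The block of the maximum becomes the
identity matrix: it is cleared, then ones are written with stride `n + 1`. An inserted minimum has
an empty basis, so its block is never initialized. -/
theorem runs_insertProg (hβ : 3 ≤ β) (hn : s.int 0 0 = n) (hm : s.int 1 0 = m) (hm0 : 0 < m)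
    (ho : o = if 0 < s.int 2 0 then 1 else 0) (ht : t = if s.int 2 (m - 1) < n then 1 else 0)
    (bm : m ≤ β) (bn : n ≤ β) (bnn : n * n ≤ β) (bmnn : m * (n * n) ≤ β)
    (b2 : ∀ k < m, bits (s.int 2 k) ≤ β) (b3 : ∀ k < m, bits (s.int 3 k) ≤ β)
    (b4 : ∀ k < m, bits (s.int 4 k) ≤ β) :
    Runs β insertProg s (3 * (m * (n * n)) + 3 * (n * n) + 3 * n + 5 * m + 19) fun s' =>
      ChainPost s n m o t s'.int ∧
      (∀ i < m * (n * n), s'.fld 1 (i + o * (n * n)) = s.fld 0 i) ∧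
      ∀ j < n, ∀ r < n, s'.fld 1 (j * n + r + (m + o) * (n * n)) = if r = j then 1 else 0 := by
  have ho1 : o ≤ 1 := by rw [ho]; split_ifs <;> omega
  have ht1 : t ≤ 1 := by rw [ht]; split_ifs <;> omega
  have b0 : bits 0 ≤ β := by simp [bits_zero]
  have b1 : bits 1 ≤ β := by rw [bits_one]; omega
  have bo' : bits (o : ℤ) ≤ β := bits_natCast_le_of_le (by omega)
  have bm' : bits (m : ℤ) ≤ β := bits_natCast_le_of_le bm
  have bn' : bits (n : ℤ) ≤ β := bits_natCast_le_of_le bn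
  have hhead := runs_headProg hβ hm hm0 hn ho ht bm' bn' b2
  clear ho ht
  unfold insertProg
  refine Runs.mono (k := 8 + ((m * 5 + 1) + (4 + ((m * (n * n) * 3 + 2) +
    ((n * n * 3 + 2) + (n * 3 + 2)))))) ?_ (by omega) fun _ h => h
  refine Runs.seq hhead fun s₁ h₁ => ?_
  refine Runs.seq (runs_copyIntProg hβ hm ho1 bm b2 b3 b4 h₁) fun s₂ h₂ => ?_
  refine Runs.seq (runs_lastProg hβ hm hn ho1 ht1 bm bn h₂ hm0) ?_
  rintro s₃ ⟨hfld, hchain⟩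
  have hvals : ∀ i : ℕ → ℕ → ℤ, ChainPost s n m o t i → i 0 0 = n ∧ i 1 0 = m ∧ i 9 0 = o :=
    fun i hi => ⟨by rw [hi.int_eq 0 (by norm_num), hn], by rw [hi.int_eq 1 (by norm_num), hm],
      hi.bot_missing⟩
  refine Runs.seq (runs_fillProg hβ (L := m * (n * n)) bmnn (by decide) (by decide)
    (fun k f => ∀ i < k, f (i + o * (n * n)) = s.fld 0 i) (fun i hi => absurd hi (Nat.not_lt_zero i))
    (fun s' h' => ?_) ?_) ?_
  · obtain ⟨e0, e1, -⟩ := hvals _ (hchain.congr h')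
    simp [IExp.Small, IExp.eval, *]
  · intro k hk s' h' hf h11 bk hI
    obtain ⟨e0, e1, e9⟩ := hvals _ (hchain.congr h')
    refine ⟨by simp [IExp.Small, IExp.eval, *], ?_, fun i hi => ?_⟩
    · simp only [FExp.cost, IExp.cost, IExp.eval, Int.toNat_zero, h11]
      omega
    · have e : IExp.eval s' (.add (.var 11) (.mul (.var 9) .block)) =
          ((k + o * (n * n) : ℕ) : ℤ) := by simp [IExp.eval, *]
      rw [e, Int.toNat_natCast]
      rcases (Nat.lt_succ_iff.1 hi).eq_or_lt with rfl | hlt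
      · simp [FExp.eval, IExp.eval, *]
      · rw [Function.update_of_ne (by omega), hI i hlt]
  rintro s₄ ⟨h₄, hf₄, hcopy⟩
  have hchain₄ := hchain.congr h₄
  refine Runs.seq (runs_fillProg hβ (L := n * n) bnn (by decide) (by decide)
    (fun k f => (∀ i < m * (n * n), f (i + o * (n * n)) = s.fld 0 i) ∧
      ∀ i < k, f (i + (m + o) * (n * n)) = 0)
    ⟨hcopy, fun i hi => absurd hi (Nat.not_lt_zero i)⟩ (fun s' h' => ?_) ?_) ?_
  · obtain ⟨e0, e1, -⟩ := hvals _ (hchain₄.congr h')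
    simp [IExp.Small, IExp.eval, *]
  · intro k hk s' h' hf h11 bk hI
    obtain ⟨e0, e1, e9⟩ := hvals _ (hchain₄.congr h')
    have e : IExp.eval s' (.add (.var 11) (.mul (.add (.get 1 (.const 0)) (.var 9)) .block)) =
        ((k + (m + o) * (n * n) : ℕ) : ℤ) := by simp [IExp.eval, *]
    rw [e, Int.toNat_natCast]
    refine ⟨by simp [IExp.Small, IExp.eval, *], by simp only [FExp.cost]; omega,
      fun i hi => ?_, fun i hi => ?_⟩
    · rw [Function.update_of_ne (by rw [add_mul]; omega), hI.1 i hi]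
    · rcases (Nat.lt_succ_iff.1 hi).eq_or_lt with rfl | hlt
      · simp [FExp.eval]
      · rw [Function.update_of_ne (by omega), hI.2 i hlt]
  rintro s₅ ⟨h₅, hf₅, hcopy₅, hzero⟩
  have hchain₅ := hchain₄.congr h₅
  refine (runs_fillProg hβ (L := n) bn (by decide) (by decide)
    (fun k f => (∀ i < m * (n * n), f (i + o * (n * n)) = s.fld 0 i) ∧
      ∀ j < n, ∀ r < n, f (j * n + r + (m + o) * (n * n)) = if r = j ∧ j < k then 1 else 0)
    ⟨hcopy₅, fun j hj r hr => ?_⟩ (fun s' h' => ?_) ?_).mono le_rfl ?_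
  · rw [hzero _ (by nlinarith), if_neg (by omega)]
  · obtain ⟨e0, e1, -⟩ := hvals _ (hchain₅.congr h')
    simp [IExp.Small, IExp.eval, *]
  · intro k hk s' h' hf h11 bk hI
    obtain ⟨e0, e1, e9⟩ := hvals _ (hchain₅.congr h')
    have e : IExp.eval s' (.add (.mul (.var 11) (.add .dim (.const 1)))
        (.mul (.add (.get 1 (.const 0)) (.var 9)) .block)) =
        ((k * n + k + (m + o) * (n * n) : ℕ) : ℤ) := by
      simp [IExp.eval, *]
      ring
    rw [e, Int.toNat_natCast]
    refine ⟨by simp [IExp.Small, IExp.eval, *], by simp only [FExp.cost]; omega,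
      fun i hi => ?_, fun j hj r hr => ?_⟩
    · rw [Function.update_of_ne (by rw [add_mul]; omega), hI.1 i hi]
    · by_cases hjr : r = k ∧ j = k
      · obtain ⟨rfl, rfl⟩ := hjr
        simp [FExp.eval]
      · have hne : j * n + r + (m + o) * (n * n) ≠ k * n + k + (m + o) * (n * n) := by
          intro h
          have h1 : r + n * j = k + n * k := by rw [mul_comm n j, mul_comm n k]; omega
          have h2 := congrArg (· % n) h1
          have h3 := congrArg (· / n) h1
          simp only [Nat.add_mul_mod_self_left, Nat.mod_eq_of_lt hr, Nat.mod_eq_of_lt hk] at h2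
          simp only [Nat.add_mul_div_left _ _ (Nat.zero_lt_of_lt hr), Nat.div_eq_of_lt hr,
            Nat.div_eq_of_lt hk] at h3
          omega
        rw [Function.update_of_ne hne, hI.2 j hj r hr]
        congr 1
        exact propext ⟨fun h => ⟨h.1, by omega⟩, fun h => ⟨h.1, by omega⟩⟩
  · rintro s' ⟨h', -, h1, h2⟩
    refine ⟨hchain₅.congr h', h1, fun j hj r hr => ?_⟩
    rw [h2 j hj r hr]
    simp [hj]

end FieldRAM

namespace FieldRAM

variable {K : Type u} [Field K] {n : ℕ}

/-! ## The resolvent program -/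

/-- `p 0 < ⋯ < p (M - 1)` is a chain from the minimum to the maximum that contains the support
of `x`. -/
structure IsFullChain (p : ℕ → SubLattice K n) (M : ℕ) (x : OrthoComplex K n) : Prop where
  lt : ∀ i j, i < j → j < M → p i < p j
  pos : 0 < M
  bot : p 0 = ⊥
  top : p (M - 1) = ⊤
  supp : ∀ r ∈ x.weight.support, ∃ i < M, p i = r

namespace IsFullChain

variable {p : ℕ → SubLattice K n} {M : ℕ} {x : OrthoComplex K n}

theorem le_iff (h : IsFullChain p M x) {i j : ℕ} (hi : i < M) (hj : j < M) :
    p i ≤ p j ↔ i ≤ j := by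
  refine ⟨fun hle => ?_, fun hle => ?_⟩
  · by_contra! hlt
    exact (h.lt j i hlt hi).not_ge hle
  · rcases hle.eq_or_lt with rfl | hlt
    exacts [le_rfl, (h.lt i j hlt hj).le]

theorem injOn (h : IsFullChain p M x) : Set.InjOn p (Finset.range M : Set ℕ) := by
  intro i hi j hj hij
  simp only [Finset.coe_range, Set.mem_Iio] at hi hj
  exact le_antisymm ((h.le_iff hi hj).1 hij.le) ((h.le_iff hj hi).1 hij.ge)

open Classical in
theorem sum_filter (h : IsFullChain p M x) (P : SubLattice K n → Prop) :
    ∑ r ∈ x.weight.support with P r, x.weight r =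
      ∑ i ∈ Finset.range M with P (p i), x.weight (p i) := by
  rw [Finset.sum_filter, Finset.sum_filter]
  have hsub : x.weight.support ⊆ (Finset.range M).image p := by
    intro r hr
    obtain ⟨i, hi, rfl⟩ := h.supp r hr
    exact Finset.mem_image_of_mem p (Finset.mem_range.2 hi)
  rw [Finset.sum_subset hsub fun r _ hr => by rw [Finsupp.notMem_support_iff.1 hr, ite_self],
    Finset.sum_image h.injOn]

theorem sum_eq_one (h : IsFullChain p M x) : ∑ i ∈ Finset.range M, x.weight (p i) = 1 := by
  have := h.sum_filter fun _ => True
  simp only [Finset.filter_true] at this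
  rw [← this]
  exact x.sum_eq_one

/-- Along a full chain the upper sets become intervals of indices, and the conventions at `⊥` and
`⊤` become those at the two ends of the index range. This identifies the output of the program with
the weights of `mapCoord`. -/
theorem mapWeight_eq (h : IsFullChain p M x) (φ : ℝ → ℝ) {l : ℕ} (hl : l < M) :
    mapWeight φ x (p l) = tailValue φ (fun i => x.weight (p i)) M l -
      tailValue φ (fun i => x.weight (p i)) M (l + 1) := by
  classical
  have hM := h.pos
  have hbot : p l = ⊥ ↔ l = 0 := by
    rw [← le_bot_iff, ← h.bot, h.le_iff hl hM, Nat.le_zero]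
  have htop : p l = ⊤ ↔ M ≤ l + 1 := by
    rw [← top_le_iff, ← h.top, h.le_iff (by omega) hl]
    omega
  have h1 : ∑ r ∈ x.weight.support with p l ≤ r, x.weight r =
      ∑ i ∈ Finset.Ico l M, x.weight (p i) := by
    rw [h.sum_filter]
    refine Finset.sum_congr ?_ fun _ _ => rfl
    ext i
    simp only [Finset.mem_filter, Finset.mem_range, Finset.mem_Ico]
    exact ⟨fun ⟨hi, hle⟩ => ⟨(h.le_iff hl hi).1 hle, hi⟩,
      fun ⟨hle, hi⟩ => ⟨hi, (h.le_iff hl hi).2 hle⟩⟩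
  have h2 : ∑ r ∈ x.weight.support with p l < r, x.weight r =
      ∑ i ∈ Finset.Ico (l + 1) M, x.weight (p i) := by
    rw [h.sum_filter]
    refine Finset.sum_congr ?_ fun _ _ => rfl
    ext i
    simp only [Finset.mem_filter, Finset.mem_range, Finset.mem_Ico]
    refine ⟨fun ⟨hi, hlt⟩ => ⟨?_, hi⟩, fun ⟨hle, hi⟩ => ⟨hi, h.lt l i hle hi⟩⟩
    by_contra! hle
    exact hlt.not_ge ((h.le_iff hi hl).2 (by omega))
  rw [mapWeight, h1, h2, tailValue, tailValue, if_neg (Nat.succ_ne_zero l), if_neg hl.not_ge]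
  simp only [hbot, htop]

end IsFullChain

/-- The chain `p 0, …, p (m - 1)`, preceded by `o` copies of the minimum and followed by copies
of the maximum. -/
def extendChain (p : ℕ → SubLattice K n) (m o i : ℕ) : SubLattice K n :=
  if i < o then ⊥ else if i < m + o then p (i - o) else ⊤

section extendChain

variable (p : ℕ → SubLattice K n) (m o : ℕ)

theorem extendChain_of_lt {i : ℕ} (hi : i < o) : extendChain p m o i = ⊥ := if_pos hi

theorem extendChain_add {k : ℕ} (hk : k < m) : extendChain p m o (k + o) = p k := by
  rw [extendChain, if_neg (by omega), if_pos (by omega), Nat.add_sub_cancel]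

theorem extendChain_top : extendChain p m o (m + o) = ⊤ := by
  rw [extendChain, if_neg (by omega), if_neg (by omega)]

end extendChain

/-- The cases for an index of the extended chain. -/
theorem extendChain_cases {m o t i : ℕ} (ho : o ≤ 1) (ht : t ≤ 1) (hi : i < m + o + t) :
    (i = 0 ∧ o = 1) ∨ (∃ k < m, i = k + o) ∨ (i = m + o ∧ t = 1) := by
  rcases lt_or_ge i o with h | h
  · exact Or.inl (by omega)
  · rcases lt_or_ge i (m + o) with h' | h'
    · exact Or.inr (Or.inl ⟨i - o, by omega, by omega⟩)
    · exact Or.inr (Or.inr (by omega))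

/-- The flags `o` and `t` test by dimension whether the ends are missing, so an end is added only
where the chain stays strictly increasing. -/
theorem isFullChain_extendChain {p : ℕ → SubLattice K n} {m o t : ℕ} {x : OrthoComplex K n}
    (hm : 0 < m) (hp : ∀ i j, i < j → j < m → p i < p j)
    (hsupp : ∀ r ∈ x.weight.support, ∃ i < m, p i = r)
    (ho : o = if 0 < Module.finrank K (p 0) then 1 else 0)
    (ht : t = if Module.finrank K (p (m - 1)) < n then 1 else 0) :
    IsFullChain (extendChain p m o) (m + o + t) x := by
  have hbot : o = 0 → p 0 = ⊥ := by
    intro h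
    rw [ho] at h
    exact Submodule.finrank_eq_zero.1 (by by_contra h'; simp [Nat.pos_of_ne_zero h'] at h)
  have htop : t = 0 → p (m - 1) = ⊤ := by
    intro h
    rw [ht] at h
    refine eq_of_le_of_finrank_le le_top ?_
    by_contra h'
    rw [if_pos (by simpa using h')] at h
    exact one_ne_zero h
  have hbot' : o = 1 → ∀ k < m, ⊥ < p k := by
    intro h k hk
    have h0 : ⊥ < p 0 := by
      rw [bot_lt_iff_ne_bot]
      intro h'
      rw [ho, h'] at h
      simp at h
    rcases Nat.eq_zero_or_pos k with rfl | hk0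
    exacts [h0, h0.trans (hp 0 k hk0 hk)]
  have htop' : t = 1 → ∀ k < m, p k < ⊤ := by
    intro h k hk
    have h0 : p (m - 1) < ⊤ := by
      rw [lt_top_iff_ne_top]
      intro h'
      rw [ht, h'] at h
      simp at h
    rcases (Nat.le_sub_one_of_lt hk).eq_or_lt with rfl | hk0
    exacts [h0, (hp k (m - 1) hk0 (by omega)).trans h0]
  have ho1 : o ≤ 1 := by rw [ho]; split_ifs <;> omega
  have ht1 : t ≤ 1 := by rw [ht]; split_ifs <;> omega
  refine ⟨fun i j hij hj => ?_, by omega, ?_, ?_, fun r hr => ?_⟩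
  · rcases extendChain_cases ho1 ht1 hj with ⟨rfl, -⟩ | ⟨k, hk, rfl⟩ | ⟨rfl, ht'⟩
    · omega
    · rw [extendChain_add p m o hk]
      rcases extendChain_cases ho1 ht1 (hij.trans hj) with ⟨rfl, ho'⟩ | ⟨l, hl, rfl⟩ | ⟨rfl, -⟩
      · rw [extendChain_of_lt p m o (by omega)]
        exact hbot' ho' k hk
      · rw [extendChain_add p m o hl]
        exact hp l k (by omega) hk
      · omega
    · rw [extendChain_top]
      rcases extendChain_cases ho1 ht1 (hij.trans hj) with ⟨rfl, ho'⟩ | ⟨l, hl, rfl⟩ | ⟨rfl, -⟩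
      · rw [extendChain_of_lt p m o (by omega)]
        exact (hbot' ho' 0 hm).trans (htop' ht' 0 hm)
      · rw [extendChain_add p m o hl]
        exact htop' ht' l hl
      · omega
  · rcases Nat.eq_zero_or_pos o with h0 | h0
    · rw [← hbot h0]
      have := extendChain_add p m o hm
      rwa [h0] at this ⊢
    · exact extendChain_of_lt p m o h0
  · rcases Nat.eq_zero_or_pos t with h0 | h0
    · rw [← htop h0, show m + o + t - 1 = (m - 1) + o by omega]
      exact extendChain_add p m o (by omega)
    · rw [show m + o + t - 1 = m + o by omega]
      exact extendChain_top p m o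
  · obtain ⟨i, hi, rfl⟩ := hsupp r hr
    exact ⟨i + o, by omega, extendChain_add p m o hi⟩

theorem span_range_single (v : ℕ → Fin n → K)
    (hv : ∀ j < n, ∀ r : Fin n, v j r = if (r : ℕ) = j then 1 else 0) :
    Submodule.span K (Set.range fun j : Fin (Module.finrank K (⊤ : SubLattice K n)) => v j) =
      ⊤ := by
  rw [← top_le_iff, ← (Pi.basisFun K (Fin n)).span_eq]
  refine Submodule.span_mono ?_
  rintro _ ⟨i, rfl⟩
  have hi : (i : ℕ) < Module.finrank K
      (Submodule.span K (Set.range (Pi.basisFun K (Fin n))) : SubLattice K n) := by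
    rw [(Pi.basisFun K (Fin n)).span_eq, finrank_top, Module.finrank_fin_fun]
    exact i.2
  refine ⟨⟨i, hi⟩, ?_⟩
  ext r
  rw [Pi.basisFun_apply, Pi.single_apply]
  refine (hv _ i.2 r).trans ?_
  simp [Fin.ext_iff]

/-- The program that computes the resolvent. -/
def resolventProg : Prog := .seq insertProg rescaleProg

theorem exists_resolvent_program : ∃ (P : Prog) (q : Polynomial ℕ),
    ∀ (K : Type u) [Field K] (n : ℕ) (c lam : ℝ), 0 < c → 0 < lam →
      ∀ (x₀ : Orthoscheme.OrthoComplex K n) (s : State K), HoldsInput s n lam c x₀ →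
        ∃ (t : ℕ) (s' : State K) (y : Orthoscheme.OrthoComplex K n),
          Exec P s t s' ∧ t ≤ q.eval (inputSize s) ∧
          HoldsPoint s' 1 n y ∧ IsResolvent (objective c) lam x₀ y := by
  -- With `γ` the input size plus 3, there are at most `100 * γ ^ 3` elementary steps, each charged
  -- `stepTime (20 * γ ^ 3)`. The cube covers the addresses of the field entries.
  refine ⟨resolventProg, 100 * (Polynomial.X + 3) ^ 3 *
    (1700 * (1 + 20 * (Polynomial.X + 3) ^ 3)), ?_⟩
  intro K _ n c lam hc hlam x s hs
  obtain ⟨hn, hld, hlam_eq, hcd, hc_eq, m, p', hmono, hsupp', hm, hdata⟩ := hs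
  simp only [Nat.mul_zero, Nat.zero_add] at hm hdata
  obtain ⟨p, hp⟩ : ∃ p : ℕ → SubLattice K n, ∀ k : Fin m, p k = p' k :=
    ⟨fun i => if h : i < m then p' ⟨i, h⟩ else ⊤, fun k => by simp⟩
  have hlt : ∀ i j, i < j → j < m → p i < p j := by
    intro i j hij hj
    have := hmono (show (⟨i, hij.trans hj⟩ : Fin m) < ⟨j, hj⟩ from hij)
    rwa [← hp, ← hp] at this
  have hsupp : ∀ r ∈ x.weight.support, ∃ i < m, p i = r := by
    intro r hr
    obtain ⟨k, rfl⟩ := hsupp' hr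
    exact ⟨k, k.2, hp k⟩
  have hdim : ∀ k < m, s.int 2 k = Module.finrank K (p k) := fun k hk => by
    rw [hp ⟨k, hk⟩]
    exact (hdata ⟨k, hk⟩).1
  have hspan : ∀ k < m, Submodule.span K (Set.range fun j : Fin (Module.finrank K (p k)) =>
      storedVector s n 0 k j) = p k := fun k hk => by
    rw [hp ⟨k, hk⟩]
    exact (hdata ⟨k, hk⟩).2.1
  have hden : ∀ k < m, 0 < s.int 4 k := fun k hk => (hdata ⟨k, hk⟩).2.2.1
  have hw : ∀ k < m, x.weight (p k) = (s.int 3 k : ℝ) / (s.int 4 k : ℝ) := fun k hk => by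
    rw [hp ⟨k, hk⟩]
    exact (hdata ⟨k, hk⟩).2.2.2
  have hnum : ∀ k < m, 0 ≤ s.int 3 k := by
    intro k hk
    have h1 := x.nonneg (p k)
    have h2 : (0 : ℝ) < s.int 4 k := by exact_mod_cast hden k hk
    rw [hw k hk, le_div_iff₀ h2, zero_mul] at h1
    exact_mod_cast h1
  have hm0 : 0 < m := by
    obtain ⟨r, hr⟩ : x.weight.support.Nonempty := by
      by_contra h
      have := x.sum_eq_one
      rw [Finset.not_nonempty_iff_eq_empty.1 h, Finset.sum_empty] at this
      exact zero_ne_one this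
    obtain ⟨i, hi, -⟩ := hsupp r hr
    omega
  obtain ⟨o, ho⟩ : ∃ o, o = if 0 < Module.finrank K (p 0) then 1 else 0 := ⟨_, rfl⟩
  obtain ⟨t, ht⟩ : ∃ t, t = if Module.finrank K (p (m - 1)) < n then 1 else 0 := ⟨_, rfl⟩
  have hfull := isFullChain_extendChain hm0 hlt hsupp ho ht
  have ho1 : o ≤ 1 := by rw [ho]; split_ifs <;> omega
  have ht1 : t ≤ 1 := by rw [ht]; split_ifs <;> omega
  -- Dimensions strictly increase along the chain, so its length is bounded by `n` and need not
  -- enter the input size.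
  have hmn : m + o + t ≤ n + 1 := by
    have hrank : ∀ i < m + o + t, i ≤ Module.finrank K (extendChain p m o i) := by
      intro i
      induction i with
      | zero => simp
      | succ i ih =>
        intro hi
        exact (ih (by omega)).trans_lt
          (Submodule.finrank_lt_finrank_of_lt (hfull.lt i (i + 1) (by omega) hi))
    have h1 := hrank (m + o + t - 1) (by omega)
    have h2 := finrank_le (extendChain p m o (m + o + t - 1))
    omega
  obtain ⟨Z, hZ⟩ : ∃ Z, Z = inputSize s := ⟨_, rfl⟩
  have hZ' : Z = n + (bits (s.int 0 1) + bits (s.int 0 2)) + (bits (s.int 0 3) + bits (s.int 0 4)) +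
      (∑ k ∈ Finset.range m, bits (s.int 3 k) + ∑ k ∈ Finset.range m, bits (s.int 4 k)) := by
    rw [hZ, inputSize, hn, hm, Int.toNat_natCast, Int.toNat_natCast, Finset.sum_add_distrib]
  have hb3 : ∀ k < m, bits (s.int 3 k) ≤ Z := by
    intro k hk
    have := Finset.single_le_sum (f := fun k => bits (s.int 3 k)) (fun _ _ => Nat.zero_le _)
      (Finset.mem_range.2 hk)
    omega
  have hb4 : ∀ k < m, bits (s.int 4 k) ≤ Z := by
    intro k hk
    have := Finset.single_le_sum (f := fun k => bits (s.int 4 k)) (fun _ _ => Nat.zero_le _)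
      (Finset.mem_range.2 hk)
    omega
  -- The 3 pays for the initial denominator 1 of the running sum and for the denominators 1 of the
  -- two subspaces that may be inserted.
  obtain ⟨γ, hγ⟩ : ∃ γ, γ = Z + 3 := ⟨_, rfl⟩
  have hγ1 : γ ≤ γ ^ 3 := Nat.le_self_pow (by norm_num) γ
  have hnn : n * n ≤ γ ^ 3 := by
    calc n * n = 1 * (n * n) := (one_mul _).symm
      _ ≤ γ * (γ * γ) :=
          Nat.mul_le_mul (by omega) (Nat.mul_le_mul (by omega) (by omega))
      _ = γ ^ 3 := by ring
  have hmnn : m * (n * n) ≤ γ ^ 3 := by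
    calc m * (n * n) ≤ γ * (γ * γ) :=
          Nat.mul_le_mul (by omega) (Nat.mul_le_mul (by omega) (by omega))
      _ = γ ^ 3 := by ring
  have hb2 : ∀ k < m, bits (s.int 2 k) ≤ 20 * γ ^ 3 := by
    intro k hk
    rw [hdim k hk]
    exact bits_natCast_le_of_le (by have := finrank_le (p k); omega)
  have hlnpos : 0 < s.int 0 1 := by
    have h2 : (0 : ℝ) < s.int 0 2 := by exact_mod_cast hld
    rw [hlam_eq, lt_div_iff₀ h2, zero_mul] at hlam
    exact_mod_cast hlam
  have hcnpos : 0 < s.int 0 3 := by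
    have h2 : (0 : ℝ) < s.int 0 4 := by exact_mod_cast hcd
    rw [hc_eq, lt_div_iff₀ h2, zero_mul] at hc
    exact_mod_cast hc
  have hinsert := runs_insertProg (β := 20 * γ ^ 3) (o := o) (t := t) (by omega) hn hm hm0
    (ho.trans (if_congr (by rw [hdim 0 hm0]; omega) rfl rfl))
    (ht.trans (if_congr (by rw [hdim (m - 1) (by omega)]; omega) rfl rfl)) (by omega)
    (by omega) (by omega) (by omega) hb2 (fun k hk => (hb3 k hk).trans (by omega))
    (fun k hk => (hb4 k hk).trans (by omega))
  -- An inserted end is not in the given chain, so its weight is zero, as encoded by the fraction `0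
  -- / 1`.
  have hzero : ∀ r, (∀ k < m, p k ≠ r) → x.weight r = 0 := by
    intro r hr
    by_contra h
    obtain ⟨i, hi, rfl⟩ := hsupp r (Finsupp.mem_support_iff.2 h)
    exact hr i hi rfl
  have hrun : Runs (20 * γ ^ 3) resolventProg s (100 * γ ^ 3) fun s' =>
      HoldsPoint s' 1 n (resolvent hc hlam x) := by
    refine (Runs.seq (k' := 13 * (m + o + t) + 8) hinsert ?_).mono (by omega) fun _ h => h
    rintro s₁ ⟨hchain, hfld, hfld'⟩
    have hweights : HoldsWeights s₁ (m + o + t) γ c lam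
        (fun i => x.weight (extendChain p m o i)) := by
      have h0 := hchain.int_eq 0 (by norm_num)
      have hentry : ∀ l < m + o + t, 0 ≤ s₁.int 7 l ∧ bits (s₁.int 7 l) ≤ γ ∧ 0 < s₁.int 8 l ∧
          x.weight (extendChain p m o l) = (s₁.int 7 l : ℝ) / (s₁.int 8 l : ℝ) := by
        intro l hl
        rcases extendChain_cases ho1 ht1 hl with ⟨rfl, ho'⟩ | ⟨k, hk, rfl⟩ | ⟨rfl, ht'⟩
        · obtain ⟨-, h7, h8⟩ := hchain.bot (by omega)
          rw [h7, h8]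
          refine ⟨le_rfl, by simp [bits_zero], one_pos, ?_⟩
          rw [hzero _ fun k hk => ?_]
          · simp
          · rw [← extendChain_add p m o hk]
            exact (hfull.lt 0 (k + o) (by omega) (by omega)).ne'
        · obtain ⟨-, h7, h8⟩ := hchain.copied k hk
          rw [h7, h8, extendChain_add p m o hk]
          exact ⟨hnum k hk, (hb3 k hk).trans (by omega), hden k hk, hw k hk⟩
        · obtain ⟨-, h7, h8⟩ := hchain.top
          rw [h7, h8]
          refine ⟨le_rfl, by simp [bits_zero], one_pos, ?_⟩
          rw [hzero _ fun k hk => ?_]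
          · simp
          · rw [← extendChain_add p m o hk]
            exact (hfull.lt (k + o) (m + o) (by omega) (by omega)).ne
      have hbits : ∑ l ∈ Finset.range (m + o + t), bits (s₁.int 8 l) ≤
          ∑ k ∈ Finset.range m, bits (s.int 4 k) + 2 := by
        have h1 : ∑ l ∈ Finset.range (o + m), bits (s₁.int 8 l) =
            ∑ l ∈ Finset.range o, bits (s₁.int 8 l) +
              ∑ k ∈ Finset.range m, bits (s.int 4 k) := by
          rw [Finset.sum_range_add]
          congr 1
          refine Finset.sum_congr rfl fun k hk => ?_
          rw [add_comm, (hchain.copied k (Finset.mem_range.1 hk)).2.2]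
        have h2 : ∑ l ∈ Finset.range o, bits (s₁.int 8 l) ≤ 1 := by
          interval_cases o
          · simp
          · simp [(hchain.bot one_pos).2.2, bits_one]
        have h3 : ∑ i ∈ Finset.range t, bits (s₁.int 8 (m + o + i)) ≤ 1 := by
          interval_cases t
          · simp
          · simp [hchain.top.2.2, bits_one]
        rw [Finset.sum_range_add, add_comm m o, h1]
        rw [add_comm m o] at h3
        omega
      refine ⟨hfull.pos, by rw [hchain.count]; push_cast; ring, by omega, h0 ▸ hlnpos, h0 ▸ hld,
        h0 ▸ hlam_eq, h0 ▸ hcnpos, h0 ▸ hcd, h0 ▸ hc_eq, fun i hi1 hi4 => ?_,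
        fun l hl => (hentry l hl).1, fun l hl => (hentry l hl).2.2.1,
        fun l hl => (hentry l hl).2.2.2, hfull.sum_eq_one.le, fun l hl => (hentry l hl).2.1,
        by omega⟩
      rw [h0]
      interval_cases i <;> omega
    refine (runs_rescaleProg hweights (by omega) (by omega)).mono le_rfl ?_
    rintro s₂ ⟨hfld₂, hint₂, hweight₂⟩
    have hrank₂ : ∀ i < m + o + t, s₁.int 6 i = Module.finrank K (extendChain p m o i) := by
      intro i hi
      rcases extendChain_cases ho1 ht1 hi with ⟨h, ho'⟩ | ⟨l, hl, h⟩ | ⟨h, ht'⟩ <;>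
        rw [h]
      · rw [extendChain_of_lt p m o (by omega), (hchain.bot (by omega)).1]
        simp
      · rw [extendChain_add p m o hl, (hchain.copied l hl).1, hdim l hl]
      · rw [extendChain_top, hchain.top.1]
        simp
    have hspan₂ : ∀ i < m + o + t, Submodule.span K (Set.range
        fun j : Fin (Module.finrank K (extendChain p m o i)) => storedVector s₂ n 1 i j) =
        extendChain p m o i := by
      intro i hi
      rcases extendChain_cases ho1 ht1 hi with ⟨h, ho'⟩ | ⟨l, hl, h⟩ | ⟨h, ht'⟩ <;>
        rw [h]
      · rw [extendChain_of_lt p m o (by omega)]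
        refine le_bot_iff.1 (Submodule.span_le.2 ?_)
        rintro _ ⟨j, rfl⟩
        have := j.2
        simp at this
      · rw [extendChain_add p m o hl]
        refine Eq.trans ?_ (hspan l hl)
        congr 2
        ext j r
        have hj : (j : ℕ) + 1 ≤ n := j.2.trans_le (finrank_le _)
        -- Only `finrank (p l) ≤ n` vectors are read, so the address stays inside block `l` and thus
        -- in the copied range.
        have hbound : (l * n + j) * n + r < m * (n * n) := by
          calc (l * n + j) * n + r < (l * n + j) * n + n := Nat.add_lt_add_left r.2 _
            _ = (l * n + (j + 1)) * n := by ring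
            _ ≤ (l * n + n) * n := by gcongr
            _ = (l + 1) * (n * n) := by ring
            _ ≤ m * (n * n) := Nat.mul_le_mul_right _ hl
        rw [storedVector, storedVector, hfld₂, ← hfld _ hbound]
        congr 1
        ring
      · rw [extendChain_top]
        refine span_range_single (fun j => storedVector s₂ n 1 (m + o) j) fun j hj r => ?_
        rw [storedVector, hfld₂, ← hfld' j hj r r.2]
        congr 1
        ring
    refine ⟨m + o + t, fun k => extendChain p m o k, fun i j hij => hfull.lt i j hij j.2,
      fun r hr => ?_, ?_, fun k => ⟨?_, ?_, (hweight₂ k k.2).1, ?_⟩⟩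
    · rcases mem_extendedSupport.1 (supp_mapCoord_subset _ _ x hr) with rfl | rfl | h
      · exact ⟨⟨0, hfull.pos⟩, hfull.bot⟩
      · exact ⟨⟨m + o + t - 1, by have := hfull.pos; omega⟩, hfull.top⟩
      · obtain ⟨i, hi, h⟩ := hfull.supp r h
        exact ⟨⟨i, hi⟩, h⟩
    · rw [hint₂ 5 (by norm_num), hchain.count]
      push_cast
      ring
    · rw [hint₂ 6 (by norm_num)]
      exact hrank₂ k k.2
    · exact hspan₂ k k.2
    · rw [(hweight₂ k k.2).2]
      exact hfull.mapWeight_eq _ k.2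
  obtain ⟨T, s', hexec, hT, hpoint⟩ := hrun
  refine ⟨T, s', resolvent hc hlam x, hexec, hT.trans (le_of_eq ?_), hpoint,
    isResolvent_resolvent hc hlam x⟩
  rw [← hZ]
  simp [stepTime, hγ]

end FieldRAM

theorem theorem3p5 :
    (∀ (K : Type u) [Field K] (n : ℕ) (c lam : ℝ), 0 < c → 0 < lam →
      ∀ x₀ : Orthoscheme.OrthoComplex K n, ∃ y : Orthoscheme.OrthoComplex K n,
        IsResolvent (objective c) lam x₀ y ∧
        (∀ y', IsResolvent (objective c) lam x₀ y' → y' = y) ∧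
        (∀ C : Set (SubLattice K n), IsMaxChain (· ≤ ·) C → x₀ ∈ subcomplex C → y ∈ subcomplex C) ∧
        (∃ a : Fin n → SubLattice K n, IsBase a ∧ x₀ ∈ subcomplex (frame a)) ∧
        (∀ a : Fin n → SubLattice K n, IsBase a → x₀ ∈ subcomplex (frame a) →
          y ∈ subcomplex (frame a) ∧
          ∀ i : Fin n,
            frameCoord a y i ∈ Set.Icc (0 : ℝ) 1 ∧
            IsMinOn (fun t : ℝ => -t + c * t ^ 2 + 1 / (2 * lam) * (t - frameCoord a x₀ i) ^ 2)
              (Set.Icc 0 1) (frameCoord a y i) ∧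
            frameCoord a y i =
              max 0 (min 1 ((frameCoord a x₀ i + lam) / (1 + 2 * c * lam))))) ∧
    (∃ (P : Prog) (q : Polynomial ℕ),
      ∀ (K : Type u) [Field K] (n : ℕ) (c lam : ℝ), 0 < c → 0 < lam →
        ∀ (x₀ : Orthoscheme.OrthoComplex K n) (s : State K), HoldsInput s n lam c x₀ →
          ∃ (t : ℕ) (s' : State K) (y : Orthoscheme.OrthoComplex K n),
            Exec P s t s' ∧ t ≤ q.eval (inputSize s) ∧
            HoldsPoint s' 1 n y ∧ IsResolvent (objective c) lam x₀ y) :=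
  ⟨exists_resolvent, exists_resolvent_program⟩
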